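/- **Setting.** Let $\Omega\subset\mathbb R^3$ be the interior of the union of a conforming triangulation $\mathcal T_h$ (finitely many nondegenerate tetrahedra $K$, any two of which meet exactly in the possibly empty face spanned by their common vertices), $\mathcal E_h^0$, $\mathcal E_h^\partial$ its interior and boundary faces, $h_e$ the diameter of a face $e$, $\langle\cdot,\cdot\rangle$ the $L^2(\Omega)$ inner product. For $r,q\ge 0$ let $U_h^{\rm grad}=CG_{r+1}^3$ (continuous, piecewise $P_{r+1}$, zero on $\partial\Omega$), $U_h^{\rm div}=\{B\in H_0({\rm div},\Omega): B|_K\in P_r^3+xP_r\}$, $U_h^{\rm curl}=\{v\in H_0({\rm curl},\Omega): v|_K\in P_r^3+x\times P_r^3\}$, $F_h=\{f: f|_K\in P_q\}$. On interior faces $[\![f]\!]=f_1n_1+f_2n_2$, $\{f\}=\frac12(f_1+f_2)$; on boundary faces $[\![f]\!]=fn$, $\{f\}=f$. The data are constants $\mu\ge0$, $\lambda+\frac23\mu\ge0$, $\kappa,\nu\ge0$, $\eta\ge0$, $\mu_0>0$; an internal energy density $\varepsilon(\rho,s)$ that is $C^1$ on $I\times J$ for open sets $I,J\subset\mathbb R$;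 a thermal boundary condition of type N (insulated), NN (given heat flux $q_0$) or D (given temperature $T_0$), with $q_0$, $T_0$ given functions on $\partial\Omega$. Put $\sigma(u)=\mu(\nabla u+\nabla u^{\sf T})+\lambda({\rm div}\,u)\delta$, $[u,v]=u\cdot\nabla v-v\cdot\nabla u$, with derivatives taken cellwise, and $$a(w,u,v)=-\int_\Omega w\cdot[u,v]\,dx,\qquad c(w,u,v)=\int_\Omega w\,\sigma(u):\nabla v\,dx,$$ $$b_h(f,g,u)=-\sum_K\int_K(u\cdot\nabla f)g\,dx+\sum_{e\in\mathcal E_h^0\cup\mathcal E_h^\partial}\int_e u\cdot[\![f]\!]\{g\}\,da,$$ $$d^N(w,f,g)=-\sum_K\int_K\tfrac wf\kappa\nabla f\cdot\nabla g\,dx+\sum_{e\in\mathcal E_h^0}\int_e\tfrac1{\{f\}}\big(\{w\kappa\nabla f\}\cdot[\![g]\!]-\{w\kappa\nabla g\}\cdot[\![f]\!]\big)da-\sum_{e\in\mathcal E_h^0}\tfrac{\eta}{h_e}\int_e\tfrac{\{w\}}{\{f\}}[\![f]\!]\cdot[\![g]\!]\,da .$$ In case N, $d=d^N$ and $e=0$.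 In case NN, $d=d^N+\int_{\partial\Omega}\frac wf\kappa\nabla f\cdot n\,g\,da$ and $e(w,f)=\int_{\partial\Omega}wq_0\,da$. In case D, $d=d^N-\int_{\partial\Omega}\frac wf\kappa\nabla g\cdot n(f-T_0)\,da+\int_{\partial\Omega}\frac wf\kappa\nabla f\cdot n\,g\,da$ and $e(w,f)=-\int_{\partial\Omega}\frac wf\kappa\nabla f\cdot n\,T_0\,da+\sum_{e\in\mathcal E^\partial_h}\frac\eta{h_e}\int_e w(f-T_0)\,da$. For a thermoelectric coefficient $\alpha$ (a given function, cellwise differentiable, which may change from step to step), $$h_\alpha(w,g,D)=-\int_{\partial\Omega}D\cdot(w\alpha n\times\nabla g)\,da+\sum_K\int_KD\cdot(\nabla(w\alpha)\times\nabla g)\,dx-\sum_{e\in\mathcal E_h^0}\int_e\{D\}\cdot\big([\![w\alpha]\!]\times\{\nabla g\}+\{\nabla(w\alpha)\}\times[\![g]\!]\big)da .$$ **Scheme.** Write $\phi_{k+\frac12}=\frac12(\phi_k+\phi_{k+1})$, and $$\delta_\rho=\tfrac12\Big(\tfrac{\varepsilon(\rho_{k+1},s_{k+1})-\varepsilon(\rho_k,s_{k+1})}{\rho_{k+1}-\rho_k}+\tfrac{\varepsilon(\rho_{k+1},s_k)-\varepsilon(\rho_k,s_k)}{\rho_{k+1}-\rho_k}\Big),\quad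 \delta_s=\tfrac12\Big(\tfrac{\varepsilon(\rho_{k+1},s_{k+1})-\varepsilon(\rho_{k+1},s_k)}{s_{k+1}-s_k}+\tfrac{\varepsilon(\rho_k,s_{k+1})-\varepsilon(\rho_k,s_k)}{s_{k+1}-s_k}\Big)$$ (a quotient is read as the partial derivative where its denominator vanishes). One step of size $\Delta t$ from $(u_k,B_k,\rho_k,s_k)$ to $(u_{k+1},B_{k+1},\rho_{k+1},s_{k+1})$, both in $U_h^{\rm grad}\times U_h^{\rm div}\times F_h\times F_h$, with auxiliary $\theta,T\in F_h$ and $\mathsf J,\mathsf H,\mathsf U,\mathsf E,\mathsf L\in U_h^{\rm curl}$, is defined by: for all $v\in U_h^{\rm grad}$, $C\in U_h^{\rm div}$, $\varsigma,w,\tau,\gamma\in F_h$, $V\in U_h^{\rm curl}$, $$\Big\langle\tfrac{\rho_{k+1}u_{k+1}-\rho_ku_k}{\Delta t},v\Big\rangle+a((\rho u)_{k+\frac12},u_{k+\frac12},v)+b_h(\theta,\rho_{k+\frac12},v)-b_h(T,s_{k+\frac12},v)+\langle\mathsf L,v\rangle=-c(1,u_{k+\frac12},v),$$ $$\Big\langle\tfrac{B_{k+1}-B_k}{\Delta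 t},C\Big\rangle+\langle{\rm curl}\,\mathsf E,C\rangle=-\nu\langle{\rm curl}\,\mathsf J,C\rangle-h_\alpha(1,T,C),\qquad\Big\langle\tfrac{\rho_{k+1}-\rho_k}{\Delta t},\varsigma\Big\rangle+b_h(\varsigma,\rho_{k+\frac12},u_{k+\frac12})=0,$$ $$\Big\langle\tfrac{s_{k+1}-s_k}{\Delta t},Tw\Big\rangle+b_h(Tw,s_{k+\frac12},u_{k+\frac12})-d(1,T,Tw)-h_\alpha\big(1,Tw,\tfrac1{\mu_0}B_{k+\frac12}\big)$$ $$\qquad=c(w,u_{k+\frac12},u_{k+\frac12})+\nu\langle w\mathsf J,\mathsf J\rangle-d(w,T,T)-e(w,T),$$ $$\langle\theta,\tau\rangle=\langle\tfrac12u_k\cdot u_{k+1}-\delta_\rho,\tau\rangle,\quad\langle T,\gamma\rangle=\langle\delta_s,\gamma\rangle,\quad\langle\mathsf J,V\rangle=\tfrac1{\mu_0}\langle B_{k+\frac12},{\rm curl}\,V\rangle,\quad\langle\mathsf H,V\rangle=\langle B_{k+\frac12},V\rangle,$$ $$\langle\mathsf U,V\rangle=\langle u_{k+\frac12},V\rangle,\quad\langle\mathsf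 E,V\rangle=-\langle\mathsf U\times\mathsf H,V\rangle,\quad\langle\mathsf L,V\rangle=-\langle\mathsf J\times\mathsf H,V\rangle.$$ **Theorem.** Consider any solution of the scheme at times $t_0<\dots<t_N$, $\Delta t_k=t_{k+1}-t_k$, with $\rho_k$ valued in $I$ and $s_k$ valued in $J$ on every closed cell. (The auxiliary fields below belong to the step $k\to k+1$.) 1. *Mass.* $\int_\Omega\rho_k\,dx=\int_\Omega\rho_0\,dx$ for all $k\le N$. 2. *Gauss' magnetic law.* In every step in which $h_\alpha(1,T,\cdot)$ vanishes on $U_h^{\rm div}$ (in particular, without thermoelectric coupling, $\alpha=0$), $\frac{B_{k+1}-B_k}{\Delta t_k}+{\rm curl}\,\mathsf E=-\nu\,{\rm curl}\,\mathsf J$ holds pointwise and ${\rm div}\,B_{k+1}={\rm div}\,B_k$. If this is so in every step and ${\rm div}\,B_0=0$, then ${\rm div}\,B_k=0$ for all $k\le N$. 3. *Magnetic helicity.* If $A_k,A_{k+1}\in H_0({\rm curl},\Omega)$ satisfy ${\rm curl}\,A_k=B_k$, ${\rm curl}\,A_{k+1}=B_{k+1}$, then, with $\pi_h^{\rm div}$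 the $L^2$-projection on $U_h^{\rm div}$, $$\frac{\langle A_{k+1},B_{k+1}\rangle-\langle A_k,B_k\rangle}{\Delta t_k}=-2\nu\langle{\rm curl}\,\mathsf J,\pi_h^{\rm div}A_{k+\frac12}\rangle-2h_\alpha(1,T,\pi_h^{\rm div}A_{k+\frac12}).$$ In particular $\langle A_{k+1},B_{k+1}\rangle=\langle A_k,B_k\rangle$ if $\nu=0$ and $h_\alpha(1,T,\cdot)=0$ on $U_h^{\rm div}$. 4. *Energy.* With $\mathcal E_k=\int_\Omega\big(\frac12\rho_k|u_k|^2+\varepsilon(\rho_k,s_k)+\frac1{2\mu_0}|B_k|^2\big)dx$, one has $(\mathcal E_{k+1}-\mathcal E_k)/\Delta t_k=-e(1,T)$. In particular $\mathcal E_k=\mathcal E_0$ for all $k\le N$ for an insulated boundary (case N). 5. *Second Law.* Suppose that $T>0$ on every closed cell, and that $w\in F_h$ is nonnegative. If the boundary is insulated, or if $w$ vanishes on all cells that have a boundary face (for example if $w$ has compact support in $\Omega$), then $c(w,u_{k+\frac12},u_{k+\frac12})\ge0$, $\nu\langle w\mathsf J,\mathsf J\rangle\ge0$, $-d(w,T,T)\ge0$,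 $e(w,T)=0$; hence both sides of the discrete entropy equation tested with $w$ are nonnegative. 6. *Symmetry.* $(X,Y)$ solves the step equations with step $\Delta t$ and some auxiliary fields if and only if $(Y,X)$ solves them with step $-\Delta t$ and the same auxiliary fields. 7. *Time reversibility.* Suppose that there is no dissipation: $\mu=\lambda=\nu=0$ and no heat exchange, i.e. $\kappa=\eta=0$ and, in case NN, $q_0=0$. Then $(u,B,\rho,s)\mapsto(u',B',\rho',s')$ is a step of size $\Delta t$ if and only if $(-u',-B',\rho',s')\mapsto(-u,-B,\rho,s)$ is one. If moreover $\alpha=0$, the same holds with $(-u',B',\rho',s')\mapsto(-u,B,\rho,s)$. -/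

import Mathlib

open MeasureTheory
open scoped Matrix ContDiff

noncomputable section

namespace MHD

/-! ## Vectors, polynomials and polynomial vector fields in three dimensions -/

/-- Three-dimensional Euclidean space. -/
abbrev E3 : Type := EuclideanSpace ℝ (Fin 3)

/-- Real polynomials in the three space coordinates. -/
abbrev Poly : Type := MvPolynomial (Fin 3) ℝ

/-- Polynomial vector fields. -/
abbrev VPoly : Type := Fin 3 → Poly

/-- Value of a polynomial at a point. -/
def ev (p : Poly) (x : E3) : ℝ := MvPolynomial.eval (fun i => x i) p

/-- Value of a polynomial vector field at a point. -/
def evv (v : VPoly) (x : E3) : E3 := WithLp.toLp 2 fun i => ev (v i) x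

/-- Cross product on `E3`. -/
def cross (a b : E3) : E3 := WithLp.toLp 2 (a.ofLp ⨯₃ b.ofLp)

def pgrad (p : Poly) : VPoly := fun i => MvPolynomial.pderiv i p

def pdiv (v : VPoly) : Poly := ∑ i, MvPolynomial.pderiv i (v i)

def pcurl (v : VPoly) : VPoly :=
  ![MvPolynomial.pderiv 1 (v 2) - MvPolynomial.pderiv 2 (v 1),
    MvPolynomial.pderiv 2 (v 0) - MvPolynomial.pderiv 0 (v 2),
    MvPolynomial.pderiv 0 (v 1) - MvPolynomial.pderiv 1 (v 0)]

def pdot (v w : VPoly) : Poly := ∑ i, v i * w i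

/-- The position field `x ↦ x`. -/
def posField : VPoly := fun i => MvPolynomial.X i

/-- The bracket `[u, v] = u · ∇ v - v · ∇ u`. -/
def bracket (u v : VPoly) : VPoly := fun i =>
  ∑ j, (u j * MvPolynomial.pderiv j (v i) - v j * MvPolynomial.pderiv j (u i))

/-- The viscous stress `σ(u) = 2 μ Def u + λ (div u) δ`. -/
def stress (mu lam : ℝ) (u : VPoly) (i j : Fin 3) : Poly :=
  MvPolynomial.C mu * (MvPolynomial.pderiv i (u j) + MvPolynomial.pderiv j (u i)) +
    if i = j then MvPolynomial.C lam * pdiv u else 0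

/-- The contraction `σ(u) : ∇ v`. -/
def stressGrad (mu lam : ℝ) (u v : VPoly) : Poly :=
  ∑ i, ∑ j, stress mu lam u i j * MvPolynomial.pderiv j (v i)

/-- `P_d`: total degree at most `d`. -/
def DegLE (d : ℕ) (p : Poly) : Prop := p.totalDegree ≤ d

/-! ## Spaces with zero boundary trace, through weak derivatives

The test functions below are smooth on the whole space and need not vanish on `∂Ω`, so
that the identities express both the weak derivative in `Ω` and the vanishing of the
tangential, respectively normal, trace on `∂Ω` (the extension by zero has the weak
derivative extended by zero). -/

/-- Curl of a smooth vector field. -/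
def curlE (φ : E3 → E3) (x : E3) : E3 :=
  let D (j i : Fin 3) : ℝ := fderiv ℝ φ x (EuclideanSpace.single j 1) i
  !₂[D 1 2 - D 2 1, D 2 0 - D 0 2, D 0 1 - D 1 0]

/-- `A ∈ H₀(curl, Ω)` and `curl A = C`. -/
def HasCurl₀ (Ω : Set E3) (A C : E3 → E3) : Prop :=
  MemLp A 2 (volume.restrict Ω) ∧ MemLp C 2 (volume.restrict Ω) ∧
    ∀ φ : E3 → E3, ContDiff ℝ ∞ φ → HasCompactSupport φ →
      ∫ x in Ω, inner ℝ (A x) (curlE φ x) = ∫ x in Ω, inner ℝ (C x) (φ x)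

/-- `B ∈ H₀(div, Ω)` and `div B = D`. -/
def HasDiv₀ (Ω : Set E3) (B : E3 → E3) (D : E3 → ℝ) : Prop :=
  MemLp B 2 (volume.restrict Ω) ∧ MemLp D 2 (volume.restrict Ω) ∧
    ∀ φ : E3 → ℝ, ContDiff ℝ ∞ φ → HasCompactSupport φ →
      ∫ x in Ω, inner ℝ (B x) (gradient φ x) = -∫ x in Ω, D x * φ x

/-! ## Triangulations -/

/-- A conforming triangulation: finitely many nondegenerate tetrahedra, any two of which
intersect exactly in the (possibly empty) face spanned by their common vertices. -/
structure Mesh where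
  card : ℕ
  simplex : Fin card → Affine.Simplex ℝ E3 3
  distinct : ∀ K L, Set.range (simplex K).points = Set.range (simplex L).points → K = L
  conforming : ∀ K L,
    convexHull ℝ (Set.range (simplex K).points) ∩ convexHull ℝ (Set.range (simplex L).points) =
      convexHull ℝ (Set.range (simplex K).points ∩ Set.range (simplex L).points)

namespace Mesh

variable (M : Mesh)

/-- The closed tetrahedron with index `K`. -/
def cell (K : Fin M.card) : Set E3 := convexHull ℝ (Set.range (M.simplex K).points)

/-- The open domain triangulated by the mesh. -/
def dom : Set E3 := interior (⋃ K, M.cell K)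

/-- A side of a cell: the cell together with the vertex opposite to the side. -/
abbrev Side : Type := Fin M.card × Fin 4

/-- Vertices of the triangular face carried by a side. -/
def sideVerts (F : M.Side) : Set E3 := (M.simplex F.1).points '' {F.2}ᶜ

/-- The closed triangular face carried by a side. -/
def side (F : M.Side) : Set E3 := convexHull ℝ (M.sideVerts F)

/-- Unit normal to a side, pointing out of its cell. -/
def normal (F : M.Side) : E3 :=
  let d := (M.simplex F.1).altitudeFoot F.2 - (M.simplex F.1).points F.2
  ‖d‖⁻¹ • d

/-- Size `h_e` of a face. -/
def hsize (F : M.Side) : ℝ := Metric.diam (M.side F)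

open Classical in
/-- Interior faces `e = K₁ ∩ K₂`, each listed once, as the pair of its two sides. -/
def interiorFaces : Finset (M.Side × M.Side) :=
  Finset.univ.filter fun e => e.1.1 < e.2.1 ∧ M.sideVerts e.1 = M.sideVerts e.2

open Classical in
/-- Boundary faces: sides that no other cell shares. Their union is `∂Ω`. -/
def boundaryFaces : Finset M.Side :=
  Finset.univ.filter fun F => ∀ G, M.sideVerts G = M.sideVerts F → G = F

/-- Broken (cellwise) polynomials. -/
abbrev Scal : Type := Fin M.card → Poly

/-- Broken polynomial vector fields. -/
abbrev Vec : Type := Fin M.card → VPoly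

/-- Cellwise values of a broken polynomial. -/
def val (f : M.Scal) : Fin M.card → E3 → ℝ := fun K => ev (f K)

/-- Cellwise values of a broken polynomial vector field. -/
def vval (v : M.Vec) : Fin M.card → E3 → E3 := fun K => evv (v K)

/-- A broken field as a field on the whole space, zero off the open cells. -/
def toFun (v : M.Vec) (x : E3) : E3 :=
  ∑ K, (interior (M.cell K)).indicator (evv (v K)) x

def curl (v : M.Vec) : M.Vec := fun K => pcurl (v K)

def div (v : M.Vec) : M.Scal := fun K => pdiv (v K)

def grad (f : M.Scal) : M.Vec := fun K => pgrad (f K)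

def smul (f : M.Scal) (v : M.Vec) : M.Vec := fun K => f K • v K

def vcross (v w : M.Vec) : M.Vec := fun K => v K ⨯₃ w K

/-- `∑_K ∫_K f dx`. -/
def int (f : Fin M.card → E3 → ℝ) : ℝ := ∑ K, ∫ x in M.cell K, f K x

/-- `∑ ∫_e g da` over interior faces; `g` may use both sides of the face. -/
def intInterior (g : M.Side → M.Side → E3 → ℝ) : ℝ :=
  ∑ e ∈ M.interiorFaces, ∫ x in M.side e.1, g e.1 e.2 x ∂μHE[2]

/-- `∫_{∂Ω} g da`, as the sum over boundary faces. -/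
def intBoundary (g : M.Side → E3 → ℝ) : ℝ :=
  ∑ F ∈ M.boundaryFaces, ∫ x in M.side F, g F x ∂μHE[2]

/-- `L²` inner product of broken polynomials. -/
def ip (f g : M.Scal) : ℝ := M.int fun K x => ev (f K) x * ev (g K) x

/-- `L²` inner product of broken polynomial vector fields. -/
def ipv (v w : M.Vec) : ℝ := M.int fun K x => inner ℝ (evv (v K) x) (evv (w K) x)

/-- `L²` inner product of a vector field on `Ω` with a broken polynomial one. -/
def ipf (A : E3 → E3) (w : M.Vec) : ℝ := M.int fun K x => inner ℝ (A x) (evv (w K) x)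

/-- Jump `⟦f⟧ = f₁ n₁ + f₂ n₂` on an interior face. -/
def jump (f : Fin M.card → E3 → ℝ) (F G : M.Side) (x : E3) : E3 :=
  f F.1 x • M.normal F + f G.1 x • M.normal G

/-- Average of a piecewise scalar function on an interior face. -/
def avg (f : Fin M.card → E3 → ℝ) (F G : M.Side) (x : E3) : ℝ :=
  (1 / 2) * (f F.1 x + f G.1 x)

/-- Average of a piecewise vector field on an interior face. -/
def vavg (v : Fin M.card → E3 → E3) (F G : M.Side) (x : E3) : E3 :=
  (1 / 2 : ℝ) • (v F.1 x + v G.1 x)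

/-! ## Finite element spaces -/

/-- Discontinuous Galerkin space `F_h = DG_s`. -/
def MemDG (s : ℕ) (f : M.Scal) : Prop := ∀ K, DegLE s (f K)

/-- Continuous Galerkin space `U_h^grad = CG_{r+1}³`: continuous, piecewise polynomial of
degree at most `r + 1`, and zero on `∂Ω`. -/
def MemCG (r : ℕ) (u : M.Vec) : Prop :=
  (∀ K i, DegLE (r + 1) (u K i)) ∧
  (∀ K L, ∀ x ∈ M.cell K ∩ M.cell L, evv (u K) x = evv (u L) x) ∧
  ∀ F ∈ M.boundaryFaces, ∀ x ∈ M.side F, evv (u F.1) x = 0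

/-- Raviart-Thomas space `U_h^div = RT_r`: in `H₀(div, Ω)`, and in `P_r³ + x P_r` on
every cell. -/
def MemRT (r : ℕ) (B : M.Vec) : Prop :=
  (∀ K, ∃ (p : VPoly) (q : Poly), (∀ i, DegLE r (p i)) ∧ DegLE r q ∧
    B K = p + q • posField) ∧
  ∃ D, HasDiv₀ M.dom (M.toFun B) D

/-- Nédélec space of the first kind `U_h^curl = NED_r`: in `H₀(curl, Ω)`, and in
`P_r³ + x × P_r³` on every cell. -/
def MemNED (r : ℕ) (v : M.Vec) : Prop :=
  (∀ K, ∃ p q : VPoly, (∀ i, DegLE r (p i)) ∧ (∀ i, DegLE r (q i)) ∧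
    v K = p + posField ⨯₃ q) ∧
  ∃ C, HasCurl₀ M.dom (M.toFun v) C

/-- `P` is the `L²(Ω)`-orthogonal projection `π_h^div A` of `A` on `U_h^div`. -/
def IsDivProj (r : ℕ) (A : E3 → E3) (P : M.Vec) : Prop :=
  M.MemRT r P ∧ ∀ C, M.MemRT r C → M.ipv P C = M.ipf A C

/-! ## Discrete advection operators -/

/-- `a(w, u, v) = -∫ w · [u, v] dx`. -/
def aForm (w u v : M.Vec) : ℝ := -M.ipv w fun K => bracket (u K) (v K)

/-- `b¹_h(f, g, u)`; the sum over faces includes the boundary faces, where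
`⟦f⟧ = f n` and `{g} = g`. The velocity `u` is single valued on the faces. -/
def b1 (f g : M.Scal) (u : M.Vec) : ℝ :=
  -M.int (fun K x => inner ℝ (evv (u K) x) (evv (pgrad (f K)) x) * ev (g K) x)
  + M.intInterior (fun F G x =>
      inner ℝ (M.vavg (M.vval u) F G x) (M.jump (M.val f) F G x) * M.avg (M.val g) F G x)
  + M.intBoundary (fun F x =>
      inner ℝ (evv (u F.1) x) (ev (f F.1) x • M.normal F) * ev (g F.1) x)

end Mesh

/-! ## Physical data -/

/-- Thermal boundary conditions: insulated boundary, given outward heat flux `q₀`, or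
given temperature `T₀`. -/
inductive ThermalBC where
  | neumann : ThermalBC
  | flux (q0 : E3 → ℝ) : ThermalBC
  | dirichlet (T0 : E3 → ℝ) : ThermalBC

/-- Constant coefficients: viscosities `μ`, `λ`, heat conductivity `κ`, resistivity `ν`,
penalty parameter `η`, magnetic permeability `μ₀`; internal energy density `ε(ρ, s)`;
thermal boundary condition. -/
structure Params where
  mu : ℝ
  lam : ℝ
  kappa : ℝ
  nu : ℝ
  eta : ℝ
  mu0 : ℝ
  eps : ℝ → ℝ → ℝ
  bc : ThermalBC
  mu_nonneg : 0 ≤ mu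
  bulk_nonneg : 0 ≤ lam + 2 / 3 * mu
  kappa_nonneg : 0 ≤ kappa
  nu_nonneg : 0 ≤ nu
  eta_nonneg : 0 ≤ eta
  mu0_pos : 0 < mu0

/-- No viscosity, no resistivity, and no heat exchange: neither heat conduction (whose
discretization includes the penalty terms) nor heat flux through the boundary. -/
def Params.DissipationFree (p : Params) : Prop :=
  p.mu = 0 ∧ p.lam = 0 ∧ p.nu = 0 ∧ p.kappa = 0 ∧ p.eta = 0 ∧
    ∀ q0, p.bc = ThermalBC.flux q0 → ∀ x, q0 x = 0

namespace Mesh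

variable (M : Mesh)

/-! ## Discrete dissipation operators -/

/-- `c(w, u, v) = ∫ w σ(u) : ∇v dx`. -/
def cForm (p : Params) (w : M.Scal) (u v : M.Vec) : ℝ :=
  M.int fun K x => ev (w K) x * ev (stressGrad p.mu p.lam (u K) (v K)) x

/-- The piecewise field `w κ ∇f`. -/
def wkGrad (p : Params) (w f : M.Scal) : Fin M.card → E3 → E3 := fun K x =>
  (ev (w K) x * p.kappa) • evv (pgrad (f K)) x

/-- Interior penalty form for homogeneous Neumann conditions. -/
def dN (p : Params) (w f g : M.Scal) : ℝ :=
  -M.int (fun K x => ev (w K) x / ev (f K) x * p.kappa *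
      inner ℝ (evv (pgrad (f K)) x) (evv (pgrad (g K)) x))
  + M.intInterior (fun F G x => 1 / M.avg (M.val f) F G x *
      inner ℝ (M.vavg (M.wkGrad p w f) F G x) (M.jump (M.val g) F G x))
  - M.intInterior (fun F G x => 1 / M.avg (M.val f) F G x *
      inner ℝ (M.vavg (M.wkGrad p w g) F G x) (M.jump (M.val f) F G x))
  - M.intInterior (fun F G x => p.eta / M.hsize F *
      (M.avg (M.val w) F G x / M.avg (M.val f) F G x *
        inner ℝ (M.jump (M.val f) F G x) (M.jump (M.val g) F G x)))

/-- Heat conduction form `d_h`. -/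
def dForm (p : Params) (w f g : M.Scal) : ℝ :=
  match p.bc with
  | .neumann => M.dN p w f g
  | .flux _ => M.dN p w f g
      + M.intBoundary (fun F x => ev (w F.1) x / ev (f F.1) x * p.kappa *
          inner ℝ (evv (pgrad (f F.1)) x) (M.normal F) * ev (g F.1) x)
  | .dirichlet T0 => M.dN p w f g
      - M.intBoundary (fun F x => ev (w F.1) x / ev (f F.1) x * p.kappa *
          inner ℝ (evv (pgrad (g F.1)) x) (M.normal F) * (ev (f F.1) x - T0 x))
      + M.intBoundary (fun F x => ev (w F.1) x / ev (f F.1) x * p.kappa *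
          inner ℝ (evv (pgrad (f F.1)) x) (M.normal F) * ev (g F.1) x)

/-- Heat exchange with the exterior `e_h`. -/
def eForm (p : Params) (w f : M.Scal) : ℝ :=
  match p.bc with
  | .neumann => 0
  | .flux q0 => M.intBoundary fun F x => ev (w F.1) x * q0 x
  | .dirichlet T0 =>
      -M.intBoundary (fun F x => ev (w F.1) x / ev (f F.1) x * p.kappa *
          inner ℝ (evv (pgrad (f F.1)) x) (M.normal F) * T0 x)
      + M.intBoundary (fun F x => p.eta / M.hsize F *
          (ev (w F.1) x * (ev (f F.1) x - T0 x)))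

/-! ## Thermoelectric coupling -/

/-- The piecewise function `w α`. -/
def wAlpha (α : Fin M.card → E3 → ℝ) (w : M.Scal) : Fin M.card → E3 → ℝ :=
  fun K x => ev (w K) x * α K x

/-- The piecewise gradient `∇(w α)`. -/
def gradWAlpha (α : Fin M.card → E3 → ℝ) (w : M.Scal) : Fin M.card → E3 → E3 :=
  fun K => gradient (M.wAlpha α w K)

/-- `h_h(w, g, D)` for the thermoelectric coefficient `α`. -/
def hForm (α : Fin M.card → E3 → ℝ) (w g : M.Scal) (D : M.Vec) : ℝ :=
  -M.intBoundary (fun F x => inner ℝ (evv (D F.1) x)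
      (cross (M.wAlpha α w F.1 x • M.normal F) (evv (pgrad (g F.1)) x)))
  + M.int (fun K x => inner ℝ (evv (D K) x)
      (cross (M.gradWAlpha α w K x) (evv (pgrad (g K)) x)))
  - M.intInterior (fun F G x => inner ℝ (M.vavg (M.vval D) F G x)
      (cross (M.jump (M.wAlpha α w) F G x) (M.vavg (M.vval (M.grad g)) F G x)))
  - M.intInterior (fun F G x => inner ℝ (M.vavg (M.vval D) F G x)
      (cross (M.vavg (M.gradWAlpha α w) F G x) (M.jump (M.val g) F G x)))

/-! ## The fully discrete scheme -/

/-- Unknowns at one time. -/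
structure State where
  u : M.Vec
  B : M.Vec
  rho : M.Scal
  s : M.Scal

/-- Auxiliary unknowns of one time step; `L` is the projected (opposite) Lorentz force. -/
structure Aux where
  theta : M.Scal
  T : M.Scal
  J : M.Vec
  H : M.Vec
  U : M.Vec
  E : M.Vec
  L : M.Vec

end Mesh

/-- Discrete derivative `δ_ρ` of the energy; a difference quotient is the derivative where
its two arguments coincide. -/
def deltaRho (ε : ℝ → ℝ → ℝ) (ρ₀ ρ₁ s₀ s₁ : ℝ) : ℝ :=
  1 / 2 * (dslope (fun a => ε a s₁) ρ₀ ρ₁ + dslope (fun a => ε a s₀) ρ₀ ρ₁)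

/-- Discrete derivative `δ_s` of the energy. -/
def deltaS (ε : ℝ → ℝ → ℝ) (ρ₀ ρ₁ s₀ s₁ : ℝ) : ℝ :=
  1 / 2 * (dslope (fun b => ε ρ₁ b) s₀ s₁ + dslope (fun b => ε ρ₀ b) s₀ s₁)

/-- The average of the values at the two ends of a time step. -/
def mid {V : Type} [AddCommGroup V] [Module ℝ V] (x y : V) : V := (1 / 2 : ℝ) • (x + y)

namespace Mesh

variable (M : Mesh)

/-- Left-hand side of the entropy equation: discrete internal entropy production, tested
with `T w`. -/
def entropyLHS (p : Params) (α : Fin M.card → E3 → ℝ) (dt : ℝ)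
    (X Y : M.State) (Z : M.Aux) (w : M.Scal) : ℝ :=
  M.ip (dt⁻¹ • (Y.s - X.s)) (Z.T * w) + M.b1 (Z.T * w) (mid X.s Y.s) (mid X.u Y.u)
    - M.dForm p 1 Z.T (Z.T * w) - M.hForm α 1 (Z.T * w) (p.mu0⁻¹ • mid X.B Y.B)

/-- Right-hand side of the entropy equation. -/
def entropyRHS (p : Params) (X Y : M.State) (Z : M.Aux) (w : M.Scal) : ℝ :=
  M.cForm p w (mid X.u Y.u) (mid X.u Y.u)
    + p.nu * M.int (fun K x => ev (w K) x * ev (pdot (Z.J K) (Z.J K)) x)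
    - M.dForm p w Z.T Z.T - M.eForm p w Z.T

/-- `Y`, with auxiliary unknowns `Z`, is obtained from `X` by one step of size `dt` of the
fully discrete scheme, with spaces of degrees `r` (velocity and magnetic field) and `q`
(density and entropy). -/
structure IsStep (r q : ℕ) (p : Params) (α : Fin M.card → E3 → ℝ) (dt : ℝ)
    (X Y : M.State) (Z : M.Aux) : Prop where
  mem_u : M.MemCG r X.u ∧ M.MemCG r Y.u
  mem_B : M.MemRT r X.B ∧ M.MemRT r Y.B
  mem_rho : M.MemDG q X.rho ∧ M.MemDG q Y.rho
  mem_s : M.MemDG q X.s ∧ M.MemDG q Y.s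
  mem_theta : M.MemDG q Z.theta
  mem_T : M.MemDG q Z.T
  mem_J : M.MemNED r Z.J
  mem_H : M.MemNED r Z.H
  mem_U : M.MemNED r Z.U
  mem_E : M.MemNED r Z.E
  mem_L : M.MemNED r Z.L
  momentum : ∀ v, M.MemCG r v →
    M.ipv (dt⁻¹ • (M.smul Y.rho Y.u - M.smul X.rho X.u)) v
      + M.aForm (mid (M.smul X.rho X.u) (M.smul Y.rho Y.u)) (mid X.u Y.u) v
      + M.b1 Z.theta (mid X.rho Y.rho) v - M.b1 Z.T (mid X.s Y.s) v + M.ipv Z.L v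
      = -M.cForm p 1 (mid X.u Y.u) v
  induction : ∀ C, M.MemRT r C →
    M.ipv (dt⁻¹ • (Y.B - X.B)) C + M.ipv (M.curl Z.E) C
      = -p.nu * M.ipv (M.curl Z.J) C - M.hForm α 1 Z.T C
  density : ∀ σ, M.MemDG q σ →
    M.ip (dt⁻¹ • (Y.rho - X.rho)) σ + M.b1 σ (mid X.rho Y.rho) (mid X.u Y.u) = 0
  entropy : ∀ w, M.MemDG q w → M.entropyLHS p α dt X Y Z w = M.entropyRHS p X Y Z w
  theta_eq : ∀ τ, M.MemDG q τ → M.ip Z.theta τ = M.int fun K x =>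
    (1 / 2 * inner ℝ (evv (X.u K) x) (evv (Y.u K) x)
      - deltaRho p.eps (ev (X.rho K) x) (ev (Y.rho K) x) (ev (X.s K) x) (ev (Y.s K) x))
      * ev (τ K) x
  T_eq : ∀ γ, M.MemDG q γ → M.ip Z.T γ = M.int fun K x =>
    deltaS p.eps (ev (X.rho K) x) (ev (Y.rho K) x) (ev (X.s K) x) (ev (Y.s K) x) * ev (γ K) x
  J_eq : ∀ V, M.MemNED r V → M.ipv Z.J V = p.mu0⁻¹ * M.ipv (mid X.B Y.B) (M.curl V)
  H_eq : ∀ V, M.MemNED r V → M.ipv Z.H V = M.ipv (mid X.B Y.B) V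
  U_eq : ∀ V, M.MemNED r V → M.ipv Z.U V = M.ipv (mid X.u Y.u) V
  E_eq : ∀ V, M.MemNED r V → M.ipv Z.E V = -M.ipv (M.vcross Z.U Z.H) V
  L_eq : ∀ V, M.MemNED r V → M.ipv Z.L V = -M.ipv (M.vcross Z.J Z.H) V

/-- The one-step relation of the scheme, without the auxiliary unknowns. -/
def Step (r q : ℕ) (p : Params) (α : Fin M.card → E3 → ℝ) (dt : ℝ) (X Y : M.State) : Prop :=
  ∃ Z, M.IsStep r q p α dt X Y Z

/-! ## Invariants -/

def mass (X : M.State) : ℝ := M.int (M.val X.rho)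

/-- Kinetic, internal and magnetic energy. -/
def energy (p : Params) (X : M.State) : ℝ := M.int fun K x =>
  1 / 2 * ev (X.rho K) x * ‖evv (X.u K) x‖ ^ 2 + p.eps (ev (X.rho K) x) (ev (X.s K) x)
    + 1 / (2 * p.mu0) * ‖evv (X.B K) x‖ ^ 2

/-- Time reversal of the velocity alone. -/
def State.revU {M : Mesh} (X : M.State) : M.State := { X with u := -X.u }

/-- Time reversal of the velocity and of the magnetic field. -/
def State.revUB {M : Mesh} (X : M.State) : M.State := { X with u := -X.u, B := -X.B }

end Mesh

end MHD

end

/-!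
All balance laws are obtained by testing the scheme with its own unknowns, as in the continuous
theory; the discrete operators are built so that the terms that cancel there still cancel.

* *Mass*: the density equation is tested with `1`. The advection form `b1 1 g u` vanishes because
  the jump of a constant is a multiple of the sum of the two unit normals at an interior face.
  That this sum is zero (`Mesh.normal_add_normal`) is where conformity of the triangulation enters:
  if two cells lay on the same side of a common face, they would overlap.
* *Energy* (`Mesh.IsStep.energy_balance`): momentum is tested with the mid-point velocity, density
  with `θ`, induction with the mid-point magnetic field over `μ₀`, entropy with `1`. The internal
  energy is handled by the exact discrete chain rule `deltaRho_mul_add_deltaS_mul`, the Lorentz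
  force by `Mesh.IsStep.ipv_curl_E`. The thermoelectric terms of the induction and the entropy
  equation cancel by homogeneity of `hForm` in its magnetic argument.
* *Gauss' law*: `curl U_h^curl ⊆ U_h^div` (`Mesh.MemNED.memRT_curl`), so the residual of the
  induction equation lies in the space it is orthogonal to, and vanishes. For this inclusion the
  weak curl of a broken polynomial field in `H₀(curl)` is identified with its cellwise curl by
  test functions supported in a single cell.
* *Helicity*: the curl is symmetric on `H₀(curl)` (`HasCurl₀.integral_inner_comm`). Both fields
  are extended by zero to the whole space, and the pairing is mollified by a test function `η`:
  `∫∫ η(x - z) C(x) · A'(z)` can be integrated by parts in `x` with the first weak formulation, the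
  result is integrated by parts in `z` with the second. As `η` is arbitrary, the cross-correlations
  of `C, A'` and of `A, C'` agree, and they are continuous because translations act continuously
  on `L²`; their values at `0` are the two integrals.
* *Second Law*: each dissipation term is nonnegative pointwise. In the heat conduction form the two
  consistency terms cancel on the diagonal (`Mesh.dN_self_nonpos`).
* *Symmetry and reversibility* are read off the equations; one lemma, `Mesh.IsStep.reverse`, treats
  both reversals.
-/

/-! ### Cellwise polynomial calculus -/

namespace MHD

@[simp] lemma ev_zero (x : E3) : ev 0 x = 0 := by simp [ev]
@[simp] lemma ev_one (x : E3) : ev 1 x = 1 := by simp [ev]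
@[simp] lemma ev_add (p q : Poly) (x : E3) : ev (p + q) x = ev p x + ev q x := by simp [ev]
@[simp] lemma ev_sub (p q : Poly) (x : E3) : ev (p - q) x = ev p x - ev q x := by simp [ev]
@[simp] lemma ev_neg (p : Poly) (x : E3) : ev (-p) x = -ev p x := by simp [ev]
@[simp] lemma ev_mul (p q : Poly) (x : E3) : ev (p * q) x = ev p x * ev q x := by simp [ev]
@[simp] lemma ev_smul (c : ℝ) (p : Poly) (x : E3) : ev (c • p) x = c * ev p x := by simp [ev]
@[simp] lemma ev_C (c : ℝ) (x : E3) : ev (MvPolynomial.C c) x = c := by simp [ev]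
@[simp] lemma ev_sum {ι : Type*} (s : Finset ι) (p : ι → Poly) (x : E3) :
    ev (∑ i ∈ s, p i) x = ∑ i ∈ s, ev (p i) x := by simp [ev]

@[simp] lemma evv_apply (v : VPoly) (x : E3) (i : Fin 3) : evv v x i = ev (v i) x := rfl

@[simp] lemma evv_zero (x : E3) : evv 0 x = 0 := by ext i; simp
@[simp] lemma evv_add (v w : VPoly) (x : E3) : evv (v + w) x = evv v x + evv w x := by
  ext i; simp
@[simp] lemma evv_neg (v : VPoly) (x : E3) : evv (-v) x = -evv v x := by ext i; simp
@[simp] lemma evv_smul (c : ℝ) (v : VPoly) (x : E3) : evv (c • v) x = c • evv v x := by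
  ext i; simp

lemma inner_evv (v w : VPoly) (x : E3) : inner ℝ (evv v x) (evv w x) = ev (pdot v w) x := by
  simp [pdot, PiLp.inner_apply, mul_comm]

lemma continuous_ev (p : Poly) : Continuous (ev p) := by
  unfold ev
  exact (MvPolynomial.continuous_eval p).comp (by fun_prop)

lemma continuous_evv (v : VPoly) : Continuous (evv v) := by
  unfold evv
  exact (PiLp.continuous_toLp 2 _).comp (continuous_pi fun i => continuous_ev (v i))

lemma pdot_comm (v w : VPoly) : pdot v w = pdot w v := by simp [pdot, mul_comm]
lemma pdot_add_left (u v w : VPoly) : pdot (u + v) w = pdot u w + pdot v w := by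
  simp [pdot, add_mul, Finset.sum_add_distrib]
lemma pdot_smul_left (c : ℝ) (v w : VPoly) : pdot (c • v) w = c • pdot v w := by
  simp [pdot, Finset.smul_sum]

@[simp] lemma pgrad_one : pgrad 1 = 0 := by ext1 i; simp [pgrad]

lemma pcurl_add (v w : VPoly) : pcurl (v + w) = pcurl v + pcurl w := by
  ext1 i; fin_cases i <;> simp [pcurl] <;> ring
lemma pcurl_smul (c : ℝ) (v : VPoly) : pcurl (c • v) = c • pcurl v := by
  ext1 i; fin_cases i <;> simp [pcurl, smul_sub]
lemma pdiv_add (v w : VPoly) : pdiv (v + w) = pdiv v + pdiv w := by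
  simp [pdiv, Finset.sum_add_distrib]
lemma pdiv_smul (c : ℝ) (v : VPoly) : pdiv (c • v) = c • pdiv v := by
  simp [pdiv, Finset.smul_sum]

lemma pderiv_comm (i j : Fin 3) (p : Poly) :
    MvPolynomial.pderiv i (MvPolynomial.pderiv j p) =
      MvPolynomial.pderiv j (MvPolynomial.pderiv i p) := by
  induction p using MvPolynomial.induction_on with
  | C a => simp
  | add p q hp hq => simp [hp, hq]
  | mul_X p n hp =>
    simp only [MvPolynomial.pderiv_mul, map_add, hp, MvPolynomial.pderiv_X]
    by_cases h1 : i = n <;> by_cases h2 : j = n <;> simp [h1, h2]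

lemma pdiv_pcurl (v : VPoly) : pdiv (pcurl v) = 0 := by
  simp only [pdiv, pcurl, Fin.sum_univ_three, Matrix.cons_val_zero, Matrix.cons_val_one,
    Matrix.cons_val, map_sub]
  rw [pderiv_comm 1 0 (v 2), pderiv_comm 2 0 (v 1), pderiv_comm 2 1 (v 0)]
  ring

lemma bracket_self (u : VPoly) : bracket u u = 0 := by
  ext1 i; simp [bracket]

lemma bracket_neg_left (u v : VPoly) : bracket (-u) v = -bracket u v := by
  ext1 i
  simp [bracket, Fin.sum_univ_three]
  ring

lemma dslope_comm (f : ℝ → ℝ) (a b : ℝ) : dslope f a b = dslope f b a := by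
  rcases eq_or_ne a b with rfl | hab
  · rfl
  · rw [dslope_of_ne _ hab, dslope_of_ne _ hab.symm, slope_comm]

lemma deltaRho_comm (ε : ℝ → ℝ → ℝ) (a b c d : ℝ) :
    deltaRho ε a b c d = deltaRho ε b a d c := by
  simp only [deltaRho, dslope_comm _ a b]; ring

lemma deltaS_comm (ε : ℝ → ℝ → ℝ) (a b c d : ℝ) :
    deltaS ε a b c d = deltaS ε b a d c := by
  simp only [deltaS, dslope_comm _ c d]; ring

/-- The discrete chain rule, for which the two averaged difference quotients are designed. -/
lemma deltaRho_mul_add_deltaS_mul (ε : ℝ → ℝ → ℝ) (a b c d : ℝ) :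
    deltaRho ε a b c d * (b - a) + deltaS ε a b c d * (d - c) = ε b d - ε a c := by
  have h1 := sub_smul_dslope (fun a => ε a d) a b
  have h2 := sub_smul_dslope (fun a => ε a c) a b
  have h3 := sub_smul_dslope (fun s => ε b s) c d
  have h4 := sub_smul_dslope (fun s => ε a s) c d
  simp only [smul_eq_mul] at h1 h2 h3 h4
  simp only [deltaRho, deltaS]
  linear_combination (h1 + h2 + h3 + h4) / 2

lemma deltaS_mul (ε : ℝ → ℝ → ℝ) (a b c d : ℝ) :
    deltaS ε a b c d * (d - c) = 1 / 2 * (ε b d - ε b c + (ε a d - ε a c)) := by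
  have h3 := sub_smul_dslope (fun s => ε b s) c d
  have h4 := sub_smul_dslope (fun s => ε a s) c d
  simp only [smul_eq_mul] at h3 h4
  simp only [deltaS]
  linear_combination (h3 + h4) / 2

lemma mid_comm {V : Type} [AddCommGroup V] [Module ℝ V] (x y : V) : mid x y = mid y x := by
  simp [mid, add_comm]

lemma mid_neg {V : Type} [AddCommGroup V] [Module ℝ V] (x y : V) : mid (-x) (-y) = -mid x y := by
  simp only [mid, ← smul_neg, neg_add]

lemma neg_inv_smul_sub {V : Type} [AddCommGroup V] [Module ℝ V] (c : ℝ) (x y : V) :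
    (-c)⁻¹ • (x - y) = c⁻¹ • (y - x) := by
  rw [inv_neg, neg_smul, ← smul_neg, neg_sub]

namespace Mesh

variable (M : Mesh)

lemma isCompact_cell (K : Fin M.card) : IsCompact (M.cell K) :=
  (Set.finite_range _).isCompact_convexHull (𝕜 := ℝ)

lemma measurableSet_cell (K : Fin M.card) : MeasurableSet (M.cell K) :=
  (M.isCompact_cell K).isClosed.measurableSet

lemma int_add {f g : Fin M.card → E3 → ℝ} (hf : ∀ K, ContinuousOn (f K) (M.cell K))
    (hg : ∀ K, ContinuousOn (g K) (M.cell K)) :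
    M.int (fun K x => f K x + g K x) = M.int f + M.int g := by
  simp only [int, ← Finset.sum_add_distrib]
  exact Finset.sum_congr rfl fun K _ => integral_add
    ((hf K).integrableOn_compact (M.isCompact_cell K))
    ((hg K).integrableOn_compact (M.isCompact_cell K))

lemma int_const_mul (c : ℝ) (f : Fin M.card → E3 → ℝ) :
    M.int (fun K x => c * f K x) = c * M.int f := by
  simp only [int, integral_const_mul, Finset.mul_sum]

lemma int_neg (f : Fin M.card → E3 → ℝ) : M.int (fun K x => -f K x) = -M.int f := by
  simpa using M.int_const_mul (-1) f

lemma int_sub {f g : Fin M.card → E3 → ℝ} (hf : ∀ K, ContinuousOn (f K) (M.cell K))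
    (hg : ∀ K, ContinuousOn (g K) (M.cell K)) :
    M.int (fun K x => f K x - g K x) = M.int f - M.int g := by
  rw [sub_eq_add_neg, ← int_neg, ← M.int_add (g := fun K x => -g K x) hf (fun K => (hg K).neg)]
  simp only [sub_eq_add_neg]

lemma int_nonneg {f : Fin M.card → E3 → ℝ} (h : ∀ K, ∀ x ∈ M.cell K, 0 ≤ f K x) :
    0 ≤ M.int f :=
  Finset.sum_nonneg fun K _ => setIntegral_nonneg (M.measurableSet_cell K) (h K)

@[simp] lemma int_zero : M.int (fun _ _ => 0) = 0 := by simp [int]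

/-- The integral over `Ω` as a linear form on broken polynomials. -/
noncomputable def polyInt : M.Scal →ₗ[ℝ] ℝ where
  toFun f := M.int (M.val f)
  map_add' f g := by
    rw [← M.int_add (f := M.val f) (g := M.val g) (fun K => (continuous_ev (f K)).continuousOn)
      (fun K => (continuous_ev (g K)).continuousOn)]
    congr 1; ext K x; simp [val]
  map_smul' c f := by
    rw [RingHom.id_apply, smul_eq_mul, ← M.int_const_mul]
    congr 1; ext K x; simp [val]

lemma polyInt_apply (f : M.Scal) : M.polyInt f = M.int (M.val f) := rfl

lemma ip_eq (f g : M.Scal) : M.ip f g = M.polyInt (f * g) := by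
  simp only [ip, polyInt_apply]
  congr 1; ext K x; simp [val]

lemma ipv_eq (v w : M.Vec) : M.ipv v w = M.polyInt fun K => pdot (v K) (w K) := by
  simp only [ipv, polyInt_apply, inner_evv]
  rfl

lemma ip_comm (f g : M.Scal) : M.ip f g = M.ip g f := by simp only [ip_eq, mul_comm]
lemma ip_add_left (f g k : M.Scal) : M.ip (f + g) k = M.ip f k + M.ip g k := by
  simp only [ip_eq, add_mul, map_add]
lemma ip_smul_left (c : ℝ) (f k : M.Scal) : M.ip (c • f) k = c * M.ip f k := by
  simp only [ip_eq, smul_mul_assoc, map_smul, smul_eq_mul]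
lemma ip_neg_left (f k : M.Scal) : M.ip (-f) k = -M.ip f k := by
  simpa using M.ip_smul_left (-1) f k
lemma ip_sub_left (f g k : M.Scal) : M.ip (f - g) k = M.ip f k - M.ip g k := by
  rw [sub_eq_add_neg, ip_add_left, ip_neg_left, sub_eq_add_neg]

lemma ipv_comm (v w : M.Vec) : M.ipv v w = M.ipv w v := by simp only [ipv_eq, pdot_comm]
lemma ipv_add_left (u v w : M.Vec) : M.ipv (u + v) w = M.ipv u w + M.ipv v w := by
  simp only [ipv_eq, Pi.add_apply, pdot_add_left]
  exact map_add M.polyInt _ _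
lemma ipv_smul_left (c : ℝ) (v w : M.Vec) : M.ipv (c • v) w = c * M.ipv v w := by
  simp only [ipv_eq, Pi.smul_apply, pdot_smul_left]
  exact map_smul M.polyInt c _
lemma ipv_neg_left (v w : M.Vec) : M.ipv (-v) w = -M.ipv v w := by
  simpa using M.ipv_smul_left (-1) v w
lemma ipv_sub_left (u v w : M.Vec) : M.ipv (u - v) w = M.ipv u w - M.ipv v w := by
  rw [sub_eq_add_neg, ipv_add_left, ipv_neg_left, sub_eq_add_neg]
lemma ipv_add_right (u v w : M.Vec) : M.ipv u (v + w) = M.ipv u v + M.ipv u w := by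
  simp only [M.ipv_comm u, ipv_add_left]
lemma ipv_smul_right (c : ℝ) (v w : M.Vec) : M.ipv v (c • w) = c * M.ipv v w := by
  simp only [M.ipv_comm v, ipv_smul_left]
lemma ipv_neg_right (v w : M.Vec) : M.ipv v (-w) = -M.ipv v w := by
  simp only [M.ipv_comm v, ipv_neg_left]
lemma curl_smul (c : ℝ) (v : M.Vec) : M.curl (c • v) = c • M.curl v :=
  funext fun K => pcurl_smul c (v K)
lemma smul_neg_right (f : M.Scal) (v : M.Vec) : M.smul f (-v) = -M.smul f v :=
  funext fun K => by simp [smul]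

lemma vval_neg (v : M.Vec) (K : Fin M.card) (x : E3) : M.vval (-v) K x = -M.vval v K x := by
  simp [vval]

lemma vavg_vval_neg (v : M.Vec) (F G : M.Side) (x : E3) :
    M.vavg (M.vval (-v)) F G x = -M.vavg (M.vval v) F G x := by
  simp only [vavg, vval_neg, ← neg_add, smul_neg]

lemma vavg_vval_smul (c : ℝ) (v : M.Vec) (F G : M.Side) (x : E3) :
    M.vavg (M.vval (c • v)) F G x = c • M.vavg (M.vval v) F G x := by
  simp only [vavg, vval, Pi.smul_apply, evv_smul, ← smul_add, smul_comm c]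

lemma intInterior_const_mul (c : ℝ) (g : M.Side → M.Side → E3 → ℝ) :
    M.intInterior (fun F G x => c * g F G x) = c * M.intInterior g := by
  simp only [intInterior, integral_const_mul, Finset.mul_sum]

lemma intBoundary_const_mul (c : ℝ) (g : M.Side → E3 → ℝ) :
    M.intBoundary (fun F x => c * g F x) = c * M.intBoundary g := by
  simp only [intBoundary, integral_const_mul, Finset.mul_sum]

lemma hForm_smul (α : Fin M.card → E3 → ℝ) (w g : M.Scal) (c : ℝ) (D : M.Vec) :
    M.hForm α w g (c • D) = c * M.hForm α w g D := by
  simp only [hForm, vavg_vval_smul, Pi.smul_apply, evv_smul, inner_smul_left, conj_trivial,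
    intInterior_const_mul, intBoundary_const_mul, int_const_mul]
  ring

lemma hForm_of_alpha_eq_zero {α : Fin M.card → E3 → ℝ} (hα : ∀ K x, α K x = 0)
    (w g : M.Scal) (D : M.Vec) : M.hForm α w g D = 0 := by
  have h0 (K) : (fun x => M.wAlpha α w K x) = fun _ => (0 : ℝ) := by
    ext x; simp [wAlpha, hα]
  have h1 : M.gradWAlpha α w = 0 := by
    funext K x
    simp only [gradWAlpha, show M.wAlpha α w K = fun _ => (0 : ℝ) from h0 K]
    simp [gradient]
  have h2 (K x) : M.wAlpha α w K x = 0 := congrFun (h0 K) x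
  have hc (a : E3) : cross 0 a = 0 := by ext i; simp [cross]
  simp [hForm, h1, h2, jump, vavg, hc, intBoundary, intInterior]

lemma b1_neg (f g : M.Scal) (u : M.Vec) : M.b1 f g (-u) = -M.b1 f g u := by
  have e1 := M.int_const_mul (-1) (fun K x =>
    inner ℝ (evv (u K) x) (evv (pgrad (f K)) x) * ev (g K) x)
  have e2 := M.intInterior_const_mul (-1) (fun F G x =>
      inner ℝ (M.vavg (M.vval u) F G x) (M.jump (M.val f) F G x) * M.avg (M.val g) F G x)
  have e3 := M.intBoundary_const_mul (-1) (fun F x =>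
      inner ℝ (evv (u F.1) x) (ev (f F.1) x • M.normal F) * ev (g F.1) x)
  simp only [neg_one_mul] at e1 e2 e3
  simp only [b1, vavg_vval_neg, Pi.neg_apply, evv_neg, inner_neg_left, neg_mul, e1, e2, e3]
  ring

lemma aForm_neg (w u v : M.Vec) : M.aForm (-w) (-u) v = M.aForm w u v := by
  simp only [aForm, ipv_neg_left, neg_neg, Pi.neg_apply, bracket_neg_left]
  rw [show (fun K => -bracket (u K) (v K)) = -(fun K => bracket (u K) (v K)) from rfl,
    ipv_neg_right]

end Mesh
end MHD

/-! ### The finite element spaces -/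

namespace MHD

lemma DegLE.add {d : ℕ} {p q : Poly} (hp : DegLE d p) (hq : DegLE d q) : DegLE d (p + q) :=
  (MvPolynomial.totalDegree_add _ _).trans (max_le hp hq)

lemma DegLE.smul {d : ℕ} {p : Poly} (c : ℝ) (hp : DegLE d p) : DegLE d (c • p) :=
  (MvPolynomial.totalDegree_smul_le _ _).trans hp

lemma DegLE.one (d : ℕ) : DegLE d 1 := by simp [DegLE]

namespace Mesh

variable (M : Mesh)

lemma toFun_add (v w : M.Vec) : M.toFun (v + w) = M.toFun v + M.toFun w := by
  classical
  ext1 x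
  simp only [toFun, Pi.add_apply, ← Finset.sum_add_distrib]
  refine Finset.sum_congr rfl fun K _ => ?_
  simp only [Set.indicator_apply, evv_add]
  split_ifs <;> simp

lemma toFun_smul (c : ℝ) (v : M.Vec) : M.toFun (c • v) = c • M.toFun v := by
  classical
  ext1 x
  simp only [toFun, Pi.smul_apply, Finset.smul_sum]
  refine Finset.sum_congr rfl fun K _ => ?_
  simp only [Set.indicator_apply, evv_smul]
  split_ifs <;> simp

end Mesh

lemma _root_.MeasureTheory.MemLp.integrable_inner_real {X F : Type*} [MeasurableSpace X]
    [NormedAddCommGroup F] [InnerProductSpace ℝ F] {μ : Measure X} {f g : X → F}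
    (hf : MemLp f 2 μ) (hg : MemLp g 2 μ) : Integrable (fun x => (inner ℝ (f x) (g x) : ℝ)) μ :=
  (hf.norm.integrable_mul hg.norm).mono (hf.1.inner hg.1) <|
    .of_forall fun x => by simpa using abs_real_inner_le_norm (f x) (g x)

/-- A smooth compactly supported factor makes the pairing with an `L²` field integrable. -/
lemma integrable_inner_of_memLp {Ω : Set E3} {A : E3 → E3} (hA : MemLp A 2 (volume.restrict Ω))
    {φ : E3 → E3} (hφ : Continuous φ) (hc : HasCompactSupport φ) :
    Integrable (fun x => inner ℝ (A x) (φ x)) (volume.restrict Ω) :=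
  hA.integrable_inner_real ((hφ.memLp_of_hasCompactSupport hc).restrict Ω)

lemma continuous_curlE {φ : E3 → E3} (hφ : ContDiff ℝ ∞ φ) : Continuous (curlE φ) := by
  have h := hφ.continuous_fderiv (by simp)
  unfold curlE
  refine (PiLp.continuous_toLp 2 _).comp (continuous_pi fun i => ?_)
  fin_cases i <;> simp <;> fun_prop

lemma hasCompactSupport_curlE {φ : E3 → E3} (hc : HasCompactSupport φ) :
    HasCompactSupport (curlE φ) := by
  refine (hc.fderiv ℝ).mono fun x hx => ?_
  contrapose! hx
  have h : fderiv ℝ φ x = 0 := by simpa using hx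
  have : curlE φ x = 0 := by ext i; fin_cases i <;> simp [curlE, h]
  simpa using this

lemma HasCurl₀.add {Ω : Set E3} {A C A' C' : E3 → E3} (h : HasCurl₀ Ω A C)
    (h' : HasCurl₀ Ω A' C') : HasCurl₀ Ω (A + A') (C + C') := by
  refine ⟨h.1.add h'.1, h.2.1.add h'.2.1, fun φ hφ hc => ?_⟩
  simp only [Pi.add_apply, inner_add_left]
  have i1 := continuous_curlE hφ
  have i2 := hasCompactSupport_curlE hc
  rw [integral_add (integrable_inner_of_memLp h.1 i1 i2) (integrable_inner_of_memLp h'.1 i1 i2),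
    integral_add (integrable_inner_of_memLp h.2.1 hφ.continuous hc)
      (integrable_inner_of_memLp h'.2.1 hφ.continuous hc), h.2.2 φ hφ hc, h'.2.2 φ hφ hc]

lemma HasCurl₀.smul {Ω : Set E3} {A C : E3 → E3} (c : ℝ) (h : HasCurl₀ Ω A C) :
    HasCurl₀ Ω (c • A) (c • C) := by
  refine ⟨h.1.const_smul c, h.2.1.const_smul c, fun φ hφ hc => ?_⟩
  simp only [Pi.smul_apply, inner_smul_left, conj_trivial, integral_const_mul, h.2.2 φ hφ hc]

lemma continuous_gradient {φ : E3 → ℝ} (hφ : ContDiff ℝ ∞ φ) : Continuous (gradient φ) :=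
  (InnerProductSpace.toDual ℝ E3).symm.continuous.comp (hφ.continuous_fderiv (by simp))

lemma hasCompactSupport_gradient {φ : E3 → ℝ} (hc : HasCompactSupport φ) :
    HasCompactSupport (gradient φ) :=
  (hc.fderiv ℝ).comp_left (g := (InnerProductSpace.toDual ℝ E3).symm) (map_zero _)

lemma HasDiv₀.add {Ω : Set E3} {B B' : E3 → E3} {D D' : E3 → ℝ} (h : HasDiv₀ Ω B D)
    (h' : HasDiv₀ Ω B' D') : HasDiv₀ Ω (B + B') (D + D') := by
  refine ⟨h.1.add h'.1, h.2.1.add h'.2.1, fun φ hφ hc => ?_⟩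
  have i1 := continuous_gradient hφ
  have i2 := hasCompactSupport_gradient hc
  have hm : MemLp φ 2 (volume.restrict Ω) :=
    (hφ.continuous.memLp_of_hasCompactSupport hc).restrict Ω
  simp only [Pi.add_apply, inner_add_left, add_mul]
  rw [integral_add (integrable_inner_of_memLp h.1 i1 i2) (integrable_inner_of_memLp h'.1 i1 i2),
    integral_add (f := fun x => D x * φ x) (g := fun x => D' x * φ x)
      (h.2.1.integrable_mul hm) (h'.2.1.integrable_mul hm),
    h.2.2 φ hφ hc, h'.2.2 φ hφ hc, neg_add]

lemma HasDiv₀.smul {Ω : Set E3} {B : E3 → E3} {D : E3 → ℝ} (c : ℝ) (h : HasDiv₀ Ω B D) :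
    HasDiv₀ Ω (c • B) (c • D) := by
  refine ⟨h.1.const_smul c, h.2.1.const_smul c, fun φ hφ hc => ?_⟩
  simp only [Pi.smul_apply, inner_smul_left, conj_trivial, smul_eq_mul, mul_assoc,
    integral_const_mul, h.2.2 φ hφ hc, mul_neg]

namespace Mesh

variable {M : Mesh}

lemma MemDG.add {q : ℕ} {f g : M.Scal} (hf : M.MemDG q f) (hg : M.MemDG q g) :
    M.MemDG q (f + g) := fun K => (hf K).add (hg K)
lemma MemDG.smul {q : ℕ} {f : M.Scal} (c : ℝ) (hf : M.MemDG q f) : M.MemDG q (c • f) :=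
  fun K => (hf K).smul c
lemma MemDG.sub {q : ℕ} {f g : M.Scal} (hf : M.MemDG q f) (hg : M.MemDG q g) :
    M.MemDG q (f - g) := by
  simpa [sub_eq_add_neg] using hf.add (hg.smul (-1))
lemma MemDG.one (q : ℕ) : M.MemDG q 1 := fun _ => DegLE.one q

lemma MemCG.add {r : ℕ} {u v : M.Vec} (hu : M.MemCG r u) (hv : M.MemCG r v) :
    M.MemCG r (u + v) :=
  ⟨fun K i => (hu.1 K i).add (hv.1 K i),
    fun K L x hx => by simp [hu.2.1 K L x hx, hv.2.1 K L x hx],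
    fun F hF x hx => by simp [hu.2.2 F hF x hx, hv.2.2 F hF x hx]⟩
lemma MemCG.smul {r : ℕ} {u : M.Vec} (c : ℝ) (hu : M.MemCG r u) : M.MemCG r (c • u) :=
  ⟨fun K i => (hu.1 K i).smul c, fun K L x hx => by simp [hu.2.1 K L x hx],
    fun F hF x hx => by simp [hu.2.2 F hF x hx]⟩
lemma MemCG.neg {r : ℕ} {u : M.Vec} (hu : M.MemCG r u) : M.MemCG r (-u) := by
  simpa using hu.smul (-1)
lemma MemCG.mid {r : ℕ} {u v : M.Vec} (hu : M.MemCG r u) (hv : M.MemCG r v) :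
    M.MemCG r (mid u v) := (hu.add hv).smul _

lemma MemRT.add {r : ℕ} {B C : M.Vec} (hB : M.MemRT r B) (hC : M.MemRT r C) :
    M.MemRT r (B + C) := by
  refine ⟨fun K => ?_, ?_⟩
  · obtain ⟨p, q, hp, hq, h⟩ := hB.1 K
    obtain ⟨p', q', hp', hq', h'⟩ := hC.1 K
    refine ⟨p + p', q + q', fun i => (hp i).add (hp' i), hq.add hq', ?_⟩
    rw [Pi.add_apply, h, h', add_smul]; abel
  · obtain ⟨D, hD⟩ := hB.2
    obtain ⟨D', hD'⟩ := hC.2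
    exact ⟨_, M.toFun_add B C ▸ hD.add hD'⟩
lemma MemRT.smul {r : ℕ} {B : M.Vec} (c : ℝ) (hB : M.MemRT r B) : M.MemRT r (c • B) := by
  refine ⟨fun K => ?_, ?_⟩
  · obtain ⟨p, q, hp, hq, h⟩ := hB.1 K
    exact ⟨c • p, c • q, fun i => (hp i).smul c, hq.smul c, by
      rw [Pi.smul_apply, h, smul_add, smul_assoc]⟩
  · obtain ⟨D, hD⟩ := hB.2
    exact ⟨_, M.toFun_smul c B ▸ hD.smul c⟩
lemma MemRT.neg {r : ℕ} {B : M.Vec} (hB : M.MemRT r B) : M.MemRT r (-B) := by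
  simpa using hB.smul (-1)
lemma MemRT.sub {r : ℕ} {B C : M.Vec} (hB : M.MemRT r B) (hC : M.MemRT r C) :
    M.MemRT r (B - C) := by
  simpa [sub_eq_add_neg] using hB.add hC.neg
lemma MemRT.mid {r : ℕ} {B C : M.Vec} (hB : M.MemRT r B) (hC : M.MemRT r C) :
    M.MemRT r (mid B C) := (hB.add hC).smul _

lemma MemNED.smul {r : ℕ} {v : M.Vec} (c : ℝ) (hv : M.MemNED r v) : M.MemNED r (c • v) := by
  refine ⟨fun K => ?_, ?_⟩
  · obtain ⟨p, q, hp, hq, h⟩ := hv.1 K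
    exact ⟨c • p, c • q, fun i => (hp i).smul c, fun i => (hq i).smul c, by
      rw [Pi.smul_apply, h, smul_add, LinearMap.map_smul_of_tower]⟩
  · obtain ⟨C, hC⟩ := hv.2
    exact ⟨_, M.toFun_smul c v ▸ hC.smul c⟩
lemma MemNED.neg {r : ℕ} {v : M.Vec} (hv : M.MemNED r v) : M.MemNED r (-v) := by
  simpa using hv.smul (-1)

/-! ### Symmetry and time reversal -/

lemma IsStep.swap {r q : ℕ} {p : Params} {α : Fin M.card → E3 → ℝ} {dt : ℝ} {X Y : M.State}
    {Z : M.Aux} (h : M.IsStep r q p α dt X Y Z) : M.IsStep r q p α (-dt) Y X Z where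
  mem_u := h.mem_u.symm
  mem_B := h.mem_B.symm
  mem_rho := h.mem_rho.symm
  mem_s := h.mem_s.symm
  mem_theta := h.mem_theta
  mem_T := h.mem_T
  mem_J := h.mem_J
  mem_H := h.mem_H
  mem_U := h.mem_U
  mem_E := h.mem_E
  mem_L := h.mem_L
  momentum v hv := by
    rw [neg_inv_smul_sub, mid_comm _ (M.smul X.rho _), mid_comm Y.u, mid_comm Y.rho,
      mid_comm Y.s]
    exact h.momentum v hv
  induction C hC := by
    rw [neg_inv_smul_sub]
    exact h.induction C hC
  density σ hσ := by
    rw [neg_inv_smul_sub, mid_comm Y.u, mid_comm Y.rho]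
    exact h.density σ hσ
  entropy w hw := by
    have := h.entropy w hw
    rw [entropyLHS, entropyRHS] at this ⊢
    rw [neg_inv_smul_sub, mid_comm Y.u, mid_comm Y.s, mid_comm Y.B]
    exact this
  theta_eq τ hτ := by
    rw [h.theta_eq τ hτ]
    simp only [real_inner_comm (evv (X.u _) _), deltaRho_comm _ (ev (X.rho _) _)]
  T_eq γ hγ := by
    rw [h.T_eq γ hγ]
    simp only [deltaS_comm _ (ev (X.rho _) _)]
  J_eq := by rw [mid_comm Y.B]; exact h.J_eq
  H_eq := by rw [mid_comm Y.B]; exact h.H_eq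
  U_eq := by rw [mid_comm Y.u]; exact h.U_eq
  E_eq := h.E_eq
  L_eq := h.L_eq

lemma isStep_comm {r q : ℕ} {p : Params} {α : Fin M.card → E3 → ℝ} {dt : ℝ} {X Y : M.State}
    {Z : M.Aux} : M.IsStep r q p α dt X Y Z ↔ M.IsStep r q p α (-dt) Y X Z :=
  ⟨IsStep.swap, fun h => by simpa using h.swap⟩

lemma cForm_eq_zero {p : Params} (h1 : p.mu = 0) (h2 : p.lam = 0) (w : M.Scal) (u v : M.Vec) :
    M.cForm p w u v = 0 := by
  simp [cForm, stressGrad, stress, h1, h2]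

lemma dN_eq_zero {p : Params} (h1 : p.kappa = 0) (h2 : p.eta = 0) (w f g : M.Scal) :
    M.dN p w f g = 0 := by
  simp [dN, wkGrad, vavg, h1, h2, intInterior]

lemma dForm_eq_zero {p : Params} (h1 : p.kappa = 0) (h2 : p.eta = 0) (w f g : M.Scal) :
    M.dForm p w f g = 0 := by
  unfold dForm
  split <;> simp [dN_eq_zero h1 h2, h1, intBoundary]

lemma eForm_eq_zero_of_dissipationFree {p : Params} (h : p.DissipationFree) (w f : M.Scal) :
    M.eForm p w f = 0 := by
  obtain ⟨-, -, -, hk, he, hq⟩ := h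
  unfold eForm
  split
  · rfl
  · next q0 hbc => simp [hq q0 hbc, intBoundary]
  · simp [hk, he, intBoundary]

lemma entropyRHS_of_dissipationFree {p : Params} (h : p.DissipationFree) (X Y : M.State)
    (Z : M.Aux) (w : M.Scal) : M.entropyRHS p X Y Z w = 0 := by
  simp [entropyRHS, cForm_eq_zero h.1 h.2.1, eForm_eq_zero_of_dissipationFree h,
    dForm_eq_zero h.2.2.2.1 h.2.2.2.2.1, h.2.2.1]

/-- Both time reversals at once: the velocity changes sign, the magnetic field is multiplied by
`σ = ±1`, and `σ = 1` is allowed if the thermoelectric coupling is absent. The electric field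
then changes by the factor `-σ`, while the Lorentz force is invariant. -/
lemma IsStep.reverse {r q : ℕ} {p : Params} (hp : p.DissipationFree)
    {α : Fin M.card → E3 → ℝ} {dt : ℝ} {X Y : M.State} {Z : M.Aux} {σ : ℝ}
    (hσ : σ = -1 ∨ σ = 1 ∧ ∀ K x, α K x = 0) (h : M.IsStep r q p α dt X Y Z) :
    M.IsStep r q p α dt ⟨-Y.u, σ • Y.B, Y.rho, Y.s⟩ ⟨-X.u, σ • X.B, X.rho, X.s⟩
      ⟨Z.theta, Z.T, σ • Z.J, σ • Z.H, -Z.U, -σ • Z.E, Z.L⟩ := by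
  have hσ2 : σ * σ = 1 := by rcases hσ with rfl | ⟨rfl, -⟩ <;> norm_num
  have hh (w g D) : σ * M.hForm α w g D = -M.hForm α w g D := by
    rcases hσ with rfl | ⟨rfl, h0⟩
    · ring
    · simp [M.hForm_of_alpha_eq_zero h0]
  have hmB : mid (σ • Y.B) (σ • X.B) = σ • mid X.B Y.B := by
    simp only [mid, ← smul_add, smul_comm σ, add_comm X.B]
  have hmu : mid (-Y.u) (-X.u) = -mid X.u Y.u := by rw [mid_neg, mid_comm]
  have hd : ∀ w f g, M.dForm p w f g = 0 := dForm_eq_zero hp.2.2.2.1 hp.2.2.2.2.1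
  have hc : ∀ w u v, M.cForm p w u v = 0 := cForm_eq_zero hp.1 hp.2.1
  have hν : p.nu = 0 := hp.2.2.1
  refine
    { mem_u := ⟨h.mem_u.2.neg, h.mem_u.1.neg⟩
      mem_B := ⟨h.mem_B.2.smul σ, h.mem_B.1.smul σ⟩
      mem_rho := h.mem_rho.symm
      mem_s := h.mem_s.symm
      mem_theta := h.mem_theta
      mem_T := h.mem_T
      mem_J := h.mem_J.smul σ
      mem_H := h.mem_H.smul σ
      mem_U := h.mem_U.neg
      mem_E := h.mem_E.smul (-σ)
      mem_L := h.mem_L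
      momentum := fun v hv => ?_
      induction := fun C hC => ?_
      density := fun τ hτ => ?_
      entropy := fun w hw => ?_
      theta_eq := fun τ hτ => ?_
      T_eq := fun γ hγ => ?_
      J_eq := fun V hV => ?_
      H_eq := fun V hV => ?_
      U_eq := fun V hV => ?_
      E_eq := fun V hV => ?_
      L_eq := fun V hV => ?_ }
  · have := h.momentum v hv
    simp only [hmu, smul_neg_right, mid_neg, aForm_neg, hc, mid_comm Y.rho, mid_comm Y.s,
      mid_comm (M.smul Y.rho _), sub_neg_eq_add, neg_add_eq_sub] at this ⊢
    exact this
  · have := h.induction C hC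
    have h3 := hh 1 Z.T C
    simp only [← smul_sub, ipv_smul_left, ipv_sub_left, curl_smul, hν] at this ⊢
    linear_combination -σ * this + h3
  · have := h.density τ hτ
    simp only [hmu, b1_neg, mid_comm Y.rho, ip_smul_left, ip_sub_left] at this ⊢
    linear_combination -this
  · have := h.entropy w hw
    simp only [entropyRHS_of_dissipationFree hp, entropyLHS] at this ⊢
    rw [hmB, smul_comm, hForm_smul]
    simp only [hd, hmu, b1_neg, mid_comm Y.s, ip_smul_left, ip_sub_left, hh] at this ⊢
    linear_combination -this
  · rw [h.theta_eq τ hτ]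
    simp only [Pi.neg_apply, evv_neg, inner_neg_neg, real_inner_comm (evv (X.u _) _),
      deltaRho_comm _ (ev (X.rho _) _)]
  · rw [h.T_eq γ hγ]
    simp only [deltaS_comm _ (ev (X.rho _) _)]
  · simp only [hmB, ipv_smul_left, h.J_eq V hV]; ring
  · simp only [hmB, ipv_smul_left, h.H_eq V hV]
  · simp only [hmu, ipv_neg_left, h.U_eq V hV]
  · have e : M.vcross (-Z.U) (σ • Z.H) = -σ • M.vcross Z.U Z.H := by
      funext K; simp [vcross]
    simp only [e, ipv_smul_left, h.E_eq V hV]; ring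
  · have e : M.vcross (σ • Z.J) (σ • Z.H) = M.vcross Z.J Z.H := by
      funext K; simp [vcross, smul_smul, hσ2]
    simp only [e, h.L_eq V hV]

lemma Step.revUB {r q : ℕ} {p : Params} (hp : p.DissipationFree) {α : Fin M.card → E3 → ℝ}
    {dt : ℝ} {X Y : M.State} (h : M.Step r q p α dt X Y) :
    M.Step r q p α dt Y.revUB X.revUB := by
  obtain ⟨Z, hZ⟩ := h
  have := hZ.reverse hp (.inl rfl)
  simp only [neg_one_smul] at this
  exact ⟨_, this⟩

lemma Step.revU {r q : ℕ} {p : Params} (hp : p.DissipationFree) {α : Fin M.card → E3 → ℝ}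
    (hα : ∀ K x, α K x = 0) {dt : ℝ} {X Y : M.State} (h : M.Step r q p α dt X Y) :
    M.Step r q p α dt Y.revU X.revU := by
  obtain ⟨Z, hZ⟩ := h
  have := hZ.reverse hp (.inr ⟨rfl, hα⟩)
  simp only [one_smul] at this
  exact ⟨_, this⟩

lemma step_revUB_iff {r q : ℕ} {p : Params} (hp : p.DissipationFree) {α : Fin M.card → E3 → ℝ}
    {dt : ℝ} {X Y : M.State} :
    M.Step r q p α dt X Y ↔ M.Step r q p α dt Y.revUB X.revUB :=
  ⟨Step.revUB hp, fun h => by simpa [State.revUB] using h.revUB hp⟩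

lemma step_revU_iff {r q : ℕ} {p : Params} (hp : p.DissipationFree) {α : Fin M.card → E3 → ℝ}
    (hα : ∀ K x, α K x = 0) {dt : ℝ} {X Y : M.State} :
    M.Step r q p α dt X Y ↔ M.Step r q p α dt Y.revU X.revU :=
  ⟨Step.revU hp hα, fun h => by simpa [State.revU] using h.revU hp hα⟩

end Mesh
end MHD

/-! ### Geometry of the triangulation -/

namespace MHD
namespace Mesh

variable (M : Mesh)

lemma affineSpan_range_points (K : Fin M.card) :
    affineSpan ℝ (Set.range (M.simplex K).points) = ⊤ := by
  rw [(M.simplex K).independent.affineSpan_eq_top_iff_card_eq_finrank_add_one]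
  simp

/-- Barycentric coordinates of a cell. -/
noncomputable def bary (K : Fin M.card) : AffineBasis (Fin 4) ℝ E3 :=
  ⟨(M.simplex K).points, (M.simplex K).independent, M.affineSpan_range_points K⟩

lemma bary_apply (K : Fin M.card) (i : Fin 4) : M.bary K i = (M.simplex K).points i := rfl

lemma mem_cell_iff {K : Fin M.card} {x : E3} : x ∈ M.cell K ↔ ∀ i, 0 ≤ (M.bary K).coord i x := by
  have := (M.bary K).convexHull_eq_nonneg_coord
  exact Set.ext_iff.1 this x

lemma convex_cell (K : Fin M.card) : Convex ℝ (M.cell K) := convex_convexHull ℝ _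

lemma side_subset_cell (F : M.Side) : M.side F ⊆ M.cell F.1 :=
  convexHull_mono (Set.image_subset_range _ _)

lemma measurableSet_side (F : M.Side) : MeasurableSet (M.side F) :=
  (((Set.toFinite {F.2}ᶜ).image _).isCompact_convexHull (𝕜 := ℝ)).isClosed.measurableSet

lemma interior_cell_nonempty (K : Fin M.card) : (interior (M.cell K)).Nonempty :=
  interior_convexHull_nonempty_iff_affineSpan_eq_top.2 (M.affineSpan_range_points K)

lemma volume_frontier_cell (K : Fin M.card) : volume (frontier (M.cell K)) = 0 :=
  (M.convex_cell K).addHaar_frontier volume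

lemma interior_cell_ae_eq (K : Fin M.card) :
    interior (M.cell K) =ᵐ[volume] M.cell K :=
  interior_ae_eq_of_null_frontier (M.volume_frontier_cell K)

lemma exists_points_notMem {K L : Fin M.card} (h : K ≠ L) :
    ∃ i, (M.simplex K).points i ∉ Set.range (M.simplex L).points := by
  by_contra! hc
  have hsub : Set.range (M.simplex K).points ⊆ Set.range (M.simplex L).points :=
    Set.range_subset_iff.2 hc
  refine h (M.distinct K L (Set.eq_of_subset_of_ncard_le hsub ?_ (Set.finite_range _)))
  simp [← Set.image_univ, Set.ncard_image_of_injective _ (M.simplex _).independent.injective]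

lemma coord_eq_zero_of_mem_affineSpan {K : Fin M.card} {i : Fin 4} {x : E3}
    (hx : x ∈ affineSpan ℝ ((M.simplex K).points '' {i}ᶜ)) : (M.bary K).coord i x = 0 := by
  refine affineSpan_induction (p := fun x => (M.bary K).coord i x = 0) hx ?_ ?_
  · rintro _ ⟨j, hj, rfl⟩
    exact (M.bary K).coord_apply_ne (fun h => hj h.symm)
  · intro c u v w hu hv hw
    rw [AffineMap.map_vadd, map_smul, AffineMap.linearMap_vsub, hu, hv, hw]
    simp

lemma volume_cell_inter {K L : Fin M.card} (h : K ≠ L) : volume (M.cell K ∩ M.cell L) = 0 := by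
  obtain ⟨i, hi⟩ := M.exists_points_notMem h
  have hsub : M.cell K ∩ M.cell L ⊆ affineSpan ℝ ((M.simplex K).points '' {i}ᶜ) := by
    rw [cell, cell, M.conforming]
    refine (convexHull_subset_affineSpan _).trans (affineSpan_mono ℝ ?_)
    rintro _ ⟨⟨j, rfl⟩, hj⟩
    exact ⟨j, fun hji => hi (by rwa [← Set.mem_singleton_iff.1 hji]), rfl⟩
  refine measure_mono_null hsub (Measure.addHaar_affineSubspace _ _ fun htop => ?_)
  have : (M.bary K).coord i (M.bary K i) = 0 :=
    M.coord_eq_zero_of_mem_affineSpan (htop ▸ AffineSubspace.mem_top ℝ _ _)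
  simp at this

lemma measurableSet_dom : MeasurableSet M.dom := isOpen_interior.measurableSet

lemma interior_cell_subset_dom (K : Fin M.card) : interior (M.cell K) ⊆ M.dom :=
  interior_mono (Set.subset_iUnion M.cell K)

lemma dom_ae_eq : M.dom =ᵐ[volume] ⋃ K, M.cell K := by
  refine Filter.EventuallyLE.antisymm (Filter.Eventually.of_forall interior_subset) ?_
  have : ∀ᵐ x, ∀ K, x ∈ interior (M.cell K) ↔ x ∈ M.cell K :=
    ae_all_iff.2 fun K => (M.interior_cell_ae_eq K).mem_iff
  filter_upwards [this] with x hx hxu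
  obtain ⟨K, hK⟩ := Set.mem_iUnion.1 hxu
  exact M.interior_cell_subset_dom K ((hx K).2 hK)

lemma volume_restrict_dom :
    volume.restrict M.dom = ∑ K, volume.restrict (M.cell K) := by
  rw [Measure.restrict_congr_set M.dom_ae_eq, Measure.restrict_iUnion_ae
    (fun K L h => M.volume_cell_inter h) (fun K => (M.measurableSet_cell K).nullMeasurableSet),
    Measure.sum_fintype]

lemma integral_dom {f : E3 → ℝ} (hf : IntegrableOn f M.dom) :
    ∫ x in M.dom, f x = ∑ K, ∫ x in M.cell K, f x := by
  have hf' := hf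
  rw [IntegrableOn, volume_restrict_dom, integrable_finsetSum_measure] at hf'
  rw [volume_restrict_dom, integral_finsetSum_measure hf']

/-! ### Broken fields as fields on the domain -/

/-- The open cells are disjoint, so that only one summand of `toFun` is nonzero. -/
lemma toFun_of_mem_interior (v : M.Vec) {K : Fin M.card} {x : E3}
    (hx : x ∈ interior (M.cell K)) : M.toFun v x = evv (v K) x := by
  rw [toFun, Finset.sum_eq_single K, Set.indicator_of_mem hx]
  · intro L _ hL
    refine Set.indicator_of_notMem (fun hxL => ?_) _
    have hopen : IsOpen (interior (M.cell K) ∩ interior (M.cell L)) :=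
      isOpen_interior.inter isOpen_interior
    have h0 : volume (interior (M.cell K) ∩ interior (M.cell L)) = 0 :=
      measure_mono_null (Set.inter_subset_inter interior_subset interior_subset)
        (M.volume_cell_inter hL.symm)
    have := (hopen.measure_eq_zero_iff volume).1 h0
    exact this.subset ⟨hx, hxL⟩
  · simp

lemma toFun_ae_eq (v : M.Vec) (K : Fin M.card) :
    M.toFun v =ᵐ[volume.restrict (M.cell K)] evv (v K) := by
  rw [← Measure.restrict_congr_set (M.interior_cell_ae_eq K)]
  exact (ae_restrict_mem isOpen_interior.measurableSet).mono
    fun x hx => M.toFun_of_mem_interior v hx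

lemma memLp_toFun (v : M.Vec) : MemLp (M.toFun v) 2 (volume.restrict M.dom) := by
  classical
  refine MemLp.restrict _ ?_
  refine memLp_finsetSum' (s := Finset.univ)
    (f := fun K => (interior (M.cell K)).indicator (evv (v K))) (fun K _ => ?_) |>.congr_norm
    ?_ ?_
  · rw [memLp_indicator_iff_restrict isOpen_interior.measurableSet]
    obtain ⟨C, hC⟩ := (M.isCompact_cell K).exists_bound_of_continuousOn
      (continuous_evv (v K)).continuousOn
    have : IsFiniteMeasure (volume.restrict (interior (M.cell K))) :=
      ⟨by
        rw [Measure.restrict_apply_univ]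
        exact (measure_mono interior_subset).trans_lt (M.isCompact_cell K).measure_lt_top⟩
    exact MemLp.of_bound (continuous_evv (v K)).aestronglyMeasurable C
      ((ae_restrict_mem isOpen_interior.measurableSet).mono fun x hx => hC x (interior_subset hx))
  · have : M.toFun v = ∑ K, (interior (M.cell K)).indicator (evv (v K)) := by
      ext1 x; simp [toFun]
    rw [this]
    exact Finset.aestronglyMeasurable_sum _ fun K _ =>
      (continuous_evv (v K)).aestronglyMeasurable.indicator isOpen_interior.measurableSet
  · exact .of_forall fun x => by simp [toFun]

/-- The `L²(Ω)` pairing of a field with a broken polynomial one, computed cell by cell. -/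
lemma ipf_eq_integral {A : E3 → E3} (hA : MemLp A 2 (volume.restrict M.dom)) (w : M.Vec) :
    M.ipf A w = ∫ x in M.dom, inner ℝ (A x) (M.toFun w x) := by
  rw [M.integral_dom (hA.integrable_inner_real (M.memLp_toFun w)), ipf, int]
  refine Finset.sum_congr rfl fun K _ => integral_congr_ae ?_
  filter_upwards [M.toFun_ae_eq w K] with x hx
  rw [hx]

lemma ipv_eq_ipf (v w : M.Vec) : M.ipv v w = M.ipf (M.toFun v) w := by
  rw [ipv, ipf, int, int]
  refine Finset.sum_congr rfl fun K _ => integral_congr_ae ?_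
  filter_upwards [M.toFun_ae_eq v K] with x hx
  rw [hx]

/-- A polynomial is determined by its values on a cell. -/
lemma eq_zero_of_ev_eq_zero {K : Fin M.card} {p : Poly}
    (h : ∀ x ∈ interior (M.cell K), ev p x = 0) : p = 0 := by
  obtain ⟨x, hx⟩ := M.interior_cell_nonempty K
  have hopen : IsOpen ((WithLp.toLp 2 : (Fin 3 → ℝ) → E3) ⁻¹' interior (M.cell K)) :=
    isOpen_interior.preimage (PiLp.continuous_toLp 2 _)
  have hx' : x.ofLp ∈ (WithLp.toLp 2 : (Fin 3 → ℝ) → E3) ⁻¹' interior (M.cell K) := hx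
  obtain ⟨δ, hδ, hball⟩ := Metric.isOpen_iff.1 hopen _ hx'
  refine MvPolynomial.funext_set (fun i => Metric.ball (x i) δ)
    (fun i => infinite_of_mem_nhds (x i) (Metric.ball_mem_nhds _ hδ)) fun y hy => ?_
  rw [map_zero]
  refine h (WithLp.toLp 2 y) (hball ?_)
  rw [ball_pi _ hδ]
  exact hy

lemma eq_zero_of_ipv_self (v : M.Vec) (h : M.ipv v v = 0) : v = 0 := by
  have hnn (K) : 0 ≤ ∫ x in M.cell K, inner ℝ (evv (v K) x) (evv (v K) x) :=
    integral_nonneg fun x => real_inner_self_nonneg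
  rw [ipv, int] at h
  have hK := (Finset.sum_eq_zero_iff_of_nonneg fun K _ => hnn K).1 h
  funext K
  have h0 := hK K (Finset.mem_univ K)
  have hcont : Continuous fun x => (inner ℝ (evv (v K) x) (evv (v K) x) : ℝ) :=
    (continuous_evv _).inner (continuous_evv _)
  rw [integral_eq_zero_iff_of_nonneg (fun x => real_inner_self_nonneg)
    (hcont.continuousOn.integrableOn_compact (M.isCompact_cell K)),
    ← Measure.restrict_congr_set (M.interior_cell_ae_eq K)] at h0
  have h1 := Measure.eqOn_open_of_ae_eq h0 isOpen_interior hcont.continuousOn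
    continuousOn_const
  funext i
  refine M.eq_zero_of_ev_eq_zero (K := K) fun x hx => ?_
  have := inner_self_eq_zero (𝕜 := ℝ).1 (h1 hx)
  rw [← evv_apply, this]; rfl

/-! ### Normals at interior faces -/

/-- The barycentric coordinate opposite to a side grows linearly along a ray from the centroid
of the side. -/
lemma coord_centroid_add (F : M.Side) {f : E3} (hf : f ∈ affineSpan ℝ (M.sideVerts F)) (t : ℝ) :
    (M.bary F.1).coord F.2 (({F.2}ᶜ : Finset (Fin 4)).centroid ℝ (M.simplex F.1).points
      + t • ((M.simplex F.1).points F.2 - f)) = t := by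
  have hm : (M.bary F.1).coord F.2
      (({F.2}ᶜ : Finset (Fin 4)).centroid ℝ (M.simplex F.1).points) = 0 := by
    refine (M.bary F.1).coord_apply_combination_of_notMem (by simp) ?_
    exact Finset.sum_centroidWeights_eq_one_of_nonempty ℝ _ ⟨F.2 + 1, by simp⟩
  rw [add_comm, ← vadd_eq_add, AffineMap.map_vadd, map_smul, ← vsub_eq_sub,
    AffineMap.linearMap_vsub, hm, M.coord_eq_zero_of_mem_affineSpan hf, ← M.bary_apply,
    AffineBasis.coord_apply_eq]
  simp

/-- Near the centroid of a side, moving off its plane towards the opposite vertex leads into the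
cell. -/
lemma exists_centroid_add_mem_cell (F : M.Side) {f : E3}
    (hf : f ∈ affineSpan ℝ (M.sideVerts F)) :
    ∃ δ : ℝ, 0 < δ ∧ ∀ t : ℝ, 0 < t → t < δ →
      ({F.2}ᶜ : Finset (Fin 4)).centroid ℝ (M.simplex F.1).points
        + t • ((M.simplex F.1).points F.2 - f) ∈ M.cell F.1 := by
  have hev : ∀ᶠ t in nhdsWithin (0 : ℝ) (Set.Ioi 0), ∀ j, 0 ≤ (M.bary F.1).coord j
      (({F.2}ᶜ : Finset (Fin 4)).centroid ℝ (M.simplex F.1).points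
        + t • ((M.simplex F.1).points F.2 - f)) := by
    rw [Filter.eventually_all]
    intro j
    by_cases hj : j = F.2
    · subst hj
      filter_upwards [self_mem_nhdsWithin] with t ht
      rw [M.coord_centroid_add F hf]
      exact le_of_lt ht
    · have hm : (M.bary F.1).coord j
          (({F.2}ᶜ : Finset (Fin 4)).centroid ℝ (M.simplex F.1).points) = (3 : ℝ)⁻¹ := by
        refine ((M.bary F.1).coord_apply_centroid (s := ({F.2}ᶜ : Finset (Fin 4))) (i := j)
          (by simpa using hj)).trans ?_
        simp [Finset.card_compl]
      refine nhdsWithin_le_nhds (Filter.Eventually.mono (p := fun t => 0 < _)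
        (Filter.Tendsto.eventually_const_lt (v := (3 : ℝ)⁻¹) (by norm_num) ?_) fun t h => h.le)
      have hcont : Continuous fun t : ℝ => (M.bary F.1).coord j
          (({F.2}ᶜ : Finset (Fin 4)).centroid ℝ (M.simplex F.1).points
            + t • ((M.simplex F.1).points F.2 - f)) :=
        (continuous_barycentric_coord (M.bary F.1) j).comp (by fun_prop)
      simpa [hm] using hcont.tendsto 0
  obtain ⟨δ, hδ, h⟩ := mem_nhdsGT_iff_exists_Ioo_subset.1 hev
  exact ⟨δ, hδ, fun t h0 h1 => M.mem_cell_iff.2 (h ⟨h0, h1⟩)⟩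

/-- The two cells at an interior face lie on different sides of it: otherwise they would meet
in points off the plane of the face, against conformity. -/
lemma normal_add_normal {F G : M.Side} (hFG : F.1 ≠ G.1) (hV : M.sideVerts F = M.sideVerts G) :
    M.normal F + M.normal G = 0 := by
  set d : M.Side → E3 := fun F => (M.simplex F.1).altitudeFoot F.2 - (M.simplex F.1).points F.2
  have hd0 (F : M.Side) : d F ≠ 0 := sub_ne_zero.2 ((M.simplex F.1).ne_altitudeFoot F.2).symm
  have hdir (F : M.Side) : ((M.simplex F.1).altitude F.2).direction
      = (vectorSpan ℝ (M.sideVerts F))ᗮ := by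
    rw [Affine.Simplex.direction_altitude, sideVerts, ← direction_affineSpan ℝ (Set.range _),
      M.affineSpan_range_points, AffineSubspace.direction_top, inf_top_eq]
  have hdm (F : M.Side) : d F ∈ ((M.simplex F.1).altitude F.2).direction :=
    AffineSubspace.vsub_mem_direction ((M.simplex F.1).altitudeFoot_mem_altitude F.2)
      ((M.simplex F.1).mem_altitude F.2)
  have hGm : d G ∈ ((M.simplex F.1).altitude F.2).direction := by
    rw [hdir, hV, ← hdir]; exact hdm G
  obtain ⟨c, hc⟩ := (finrank_eq_one_iff_of_nonzero'
    (⟨d F, hdm F⟩ : ((M.simplex F.1).altitude F.2).direction)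
    (fun h => hd0 F (congrArg Subtype.val h))).1
    ((M.simplex F.1).finrank_direction_altitude F.2) ⟨d G, hGm⟩
  replace hc : c • d F = d G := congrArg Subtype.val hc
  have hc0 : c ≠ 0 := fun h => hd0 G (by rw [← hc, h, zero_smul])
  -- both `d F` and `d G` span the line orthogonal to the face; the sign of `c` decides on which
  -- side of the face the second cell lies
  have hneg : c < 0 := by
    by_contra! hpos
    replace hpos : 0 < c := lt_of_le_of_ne hpos hc0.symm
    set m := ({F.2}ᶜ : Finset (Fin 4)).centroid ℝ (M.simplex F.1).points
    have hm : m = ({G.2}ᶜ : Finset (Fin 4)).centroid ℝ (M.simplex G.1).points := by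
      refine Finset.centroid_eq_of_inj_on_of_image_eq ℝ _ (s := {F.2}ᶜ)
        (fun i _ j _ h => (M.simplex F.1).independent.injective h)
        (fun i _ j _ h => (M.simplex G.1).independent.injective h) ?_
      simpa [sideVerts] using hV
    obtain ⟨δ₁, h₁, H₁⟩ := M.exists_centroid_add_mem_cell F
      ((M.simplex F.1).altitudeFoot_mem_affineSpan_image_compl F.2)
    obtain ⟨δ₂, h₂, H₂⟩ := M.exists_centroid_add_mem_cell G
      ((M.simplex G.1).altitudeFoot_mem_affineSpan_image_compl G.2)
    set t := min (δ₁ / 2) (c * (δ₂ / 2))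
    have ht : 0 < t := lt_min (by positivity) (by positivity)
    have ht1 : t < δ₁ := (min_le_left _ _).trans_lt (by linarith)
    have ht2 : t / c < δ₂ := by
      rw [div_lt_iff₀ hpos]
      refine (min_le_right _ _).trans_lt ?_
      nlinarith
    have e1 := H₁ t ht ht1
    have e2 := H₂ (t / c) (by positivity) ht2
    rw [← hm] at e2
    have hx : (t / c) • ((M.simplex G.1).points G.2 - (M.simplex G.1).altitudeFoot G.2)
        = t • ((M.simplex F.1).points F.2 - (M.simplex F.1).altitudeFoot F.2) := by
      rw [← neg_sub, ← neg_sub ((M.simplex F.1).altitudeFoot F.2), smul_neg, smul_neg]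
      change -((t / c) • d G) = -(t • d F)
      rw [← hc, smul_smul, div_mul_cancel₀ _ hc0]
    rw [hx] at e2
    -- by conformity this common point lies in the plane of the face, although its barycentric
    -- coordinate is `t > 0`
    have hmem : m + t • ((M.simplex F.1).points F.2 - (M.simplex F.1).altitudeFoot F.2)
        ∈ affineSpan ℝ ((M.simplex F.1).points '' {F.2}ᶜ) := by
      have hc := M.conforming F.1 G.1
      refine (affineSpan_mono ℝ ?_) (convexHull_subset_affineSpan _ (hc.subset ⟨e1, e2⟩))
      obtain ⟨i, hi⟩ := M.exists_points_notMem hFG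
      have hiF : i = F.2 := by
        by_contra hne
        have : (M.simplex F.1).points i ∈ M.sideVerts G := hV ▸ ⟨i, hne, rfl⟩
        obtain ⟨j, -, hj⟩ := this
        exact hi ⟨j, hj⟩
      rintro _ ⟨⟨j, rfl⟩, hj⟩
      exact ⟨j, fun hji => hi (by rw [hiF, ← Set.mem_singleton_iff.1 hji]; exact hj), rfl⟩
    have hz := M.coord_eq_zero_of_mem_affineSpan hmem
    rw [M.coord_centroid_add F
      ((M.simplex F.1).altitudeFoot_mem_affineSpan_image_compl F.2)] at hz
    exact ht.ne' hz
  change ‖d F‖⁻¹ • d F + ‖d G‖⁻¹ • d G = 0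
  have hn : ‖d F‖ ≠ 0 := norm_ne_zero_iff.2 (hd0 F)
  rw [← hc, norm_smul, Real.norm_of_nonpos hneg.le, smul_smul, ← add_smul]
  have : ‖d F‖⁻¹ + (-c * ‖d F‖)⁻¹ * c = 0 := by field_simp; ring
  rw [this, zero_smul]

lemma normal_add_normal_of_mem {e : M.Side × M.Side} (he : e ∈ M.interiorFaces) :
    M.normal e.1 + M.normal e.2 = 0 := by
  simp only [interiorFaces, Finset.mem_filter] at he
  exact M.normal_add_normal he.2.1.ne he.2.2

end Mesh
end MHD

/-! ### Mass, energy and entropy -/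

namespace MHD
namespace Mesh

variable {M : Mesh}

/-- Constants are not advected: the jump of `1` is the sum of the two normals, and `u`
vanishes on the boundary. -/
lemma b1_one {r : ℕ} {u : M.Vec} (hu : M.MemCG r u) (g : M.Scal) : M.b1 1 g u = 0 := by
  have h1 : M.intInterior (fun F G x => inner ℝ (M.vavg (M.vval u) F G x)
      (M.jump (M.val 1) F G x) * M.avg (M.val g) F G x) = 0 := by
    refine Finset.sum_eq_zero fun e he => ?_
    simp [jump, val, M.normal_add_normal_of_mem he]
  have h2 : M.intBoundary (fun F x => inner ℝ (evv (u F.1) x)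
      (ev ((1 : M.Scal) F.1) x • M.normal F) * ev (g F.1) x) = 0 := by
    refine Finset.sum_eq_zero fun F hF => ?_
    rw [setIntegral_congr_fun (g := fun _ => 0) (M.measurableSet_side F)
      fun x hx => by simp [hu.2.2 F hF x hx]]
    simp
  rw [b1, h1, h2]
  simp

section Step

variable {r q : ℕ} {p : Params} {α : Fin M.card → E3 → ℝ} {dt : ℝ} {X Y : M.State} {Z : M.Aux}

lemma IsStep.mass_eq (h : M.IsStep r q p α dt X Y Z) (hdt : dt ≠ 0) : M.mass Y = M.mass X := by
  have h1 := h.density 1 (MemDG.one q)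
  rw [b1_one (h.mem_u.1.mid h.mem_u.2), add_zero, ip_smul_left, ip_sub_left, ip_eq, ip_eq,
    mul_one, mul_one] at h1
  have := (mul_eq_zero.1 h1).resolve_left (inv_ne_zero hdt)
  exact sub_eq_zero.1 this

/-- The magnetic terms of the energy balance: the work of the Lorentz force cancels against the
ideal part of the induction equation, because both pass through the same projected triple
product. -/
lemma IsStep.ipv_curl_E (h : M.IsStep r q p α dt X Y Z) :
    p.mu0⁻¹ * M.ipv (M.curl Z.E) (mid X.B Y.B) = -M.ipv Z.L (mid X.u Y.u) := by
  have hJ := h.J_eq Z.E h.mem_E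
  have hU := h.U_eq Z.L h.mem_L
  have hE := h.E_eq Z.J h.mem_J
  have hL := h.L_eq Z.U h.mem_U
  have htriple : M.ipv (M.vcross Z.U Z.H) Z.J = -M.ipv (M.vcross Z.J Z.H) Z.U := by
    rw [← ipv_neg_left, ipv_eq, ipv_eq]
    congr 1
    funext K
    simp only [pdot, vcross, Fin.sum_univ_three, Pi.neg_apply, cross_apply, Matrix.cons_val_zero,
      Matrix.cons_val_one, Matrix.cons_val]
    ring
  rw [M.ipv_comm (M.curl Z.E), M.ipv_comm Z.L, ← hJ, ← hU, M.ipv_comm Z.J, hE, M.ipv_comm Z.U, hL,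
    htriple]

lemma continuousOn_eps {I J : Set ℝ}
    (hε : ContinuousOn (fun z : ℝ × ℝ => p.eps z.1 z.2) (I ×ˢ J)) {f g : M.Scal}
    {K : Fin M.card} (hf : ∀ x ∈ M.cell K, ev (f K) x ∈ I) (hg : ∀ x ∈ M.cell K, ev (g K) x ∈ J) :
    ContinuousOn (fun x => p.eps (ev (f K) x) (ev (g K) x)) (M.cell K) :=
  hε.comp (f := fun x => (ev (f K) x, ev (g K) x))
    ((continuous_ev _).prodMk (continuous_ev _)).continuousOn fun x hx => ⟨hf x hx, hg x hx⟩

lemma energy_eq {I J : Set ℝ}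
    (hε : ContinuousOn (fun z : ℝ × ℝ => p.eps z.1 z.2) (I ×ˢ J)) {X : M.State}
    (hX : ∀ K, ∀ x ∈ M.cell K, ev (X.rho K) x ∈ I ∧ ev (X.s K) x ∈ J) :
    M.energy p X = 1 / 2 * M.ipv (M.smul X.rho X.u) X.u
      + M.int (fun K x => p.eps (ev (X.rho K) x) (ev (X.s K) x))
      + 1 / (2 * p.mu0) * M.ipv X.B X.B := by
  have hc (K) := continuousOn_eps (M := M) hε (fun x hx => (hX K x hx).1)
    (fun x hx => (hX K x hx).2)
  have hp (c : ℝ) (v w : VPoly) (K : Fin M.card) :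
      ContinuousOn (fun x => c * inner ℝ (evv v x) (evv w x)) (M.cell K) :=
    (continuous_const.mul ((continuous_evv v).inner (continuous_evv w))).continuousOn
  rw [ipv, ipv, ← int_const_mul, ← int_const_mul, ← int_add _ (fun K => hp _ _ _ K) hc,
    ← int_add (f := fun K x => _ + _) _ (fun K => (hp _ _ _ K).add (hc K)) (fun K => hp _ _ _ K),
    energy]
  congr 1
  funext K x
  have : evv (M.smul X.rho X.u K) x = ev (X.rho K) x • evv (X.u K) x := by
    ext i; simp [smul]
  simp only [this, inner_smul_left, real_inner_self_eq_norm_sq, conj_trivial, mul_assoc]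

/-- The discrete chain rule for the internal energy, integrated against the equations that define
`θ` and `T`. -/
lemma IsStep.internal_energy {I J : Set ℝ}
    (hε : ContinuousOn (fun z : ℝ × ℝ => p.eps z.1 z.2) (I ×ˢ J))
    (hX : ∀ K, ∀ x ∈ M.cell K, ev (X.rho K) x ∈ I ∧ ev (X.s K) x ∈ J)
    (hY : ∀ K, ∀ x ∈ M.cell K, ev (Y.rho K) x ∈ I ∧ ev (Y.s K) x ∈ J)
    (h : M.IsStep r q p α dt X Y Z) :
    M.int (fun K x => p.eps (ev (Y.rho K) x) (ev (Y.s K) x))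
        - M.int (fun K x => p.eps (ev (X.rho K) x) (ev (X.s K) x))
      = 1 / 2 * M.ipv (M.smul (Y.rho - X.rho) X.u) Y.u - M.ip Z.theta (Y.rho - X.rho)
        + M.ip Z.T (Y.s - X.s) := by
  have c11 (K) := continuousOn_eps (M := M) hε (fun x hx => (hX K x hx).1)
    (fun x hx => (hX K x hx).2)
  have c22 (K) := continuousOn_eps (M := M) hε (fun x hx => (hY K x hx).1)
    (fun x hx => (hY K x hx).2)
  have c12 (K) := continuousOn_eps (M := M) hε (fun x hx => (hX K x hx).1)
    (fun x hx => (hY K x hx).2)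
  have c21 (K) := continuousOn_eps (M := M) hε (fun x hx => (hY K x hx).1)
    (fun x hx => (hX K x hx).2)
  -- `S = δ_s (s' - s)`, written without the quotient, so that its continuity is visible
  set S : Fin M.card → E3 → ℝ := fun K x => 1 / 2 *
    (p.eps (ev (Y.rho K) x) (ev (Y.s K) x) - p.eps (ev (Y.rho K) x) (ev (X.s K) x)
      + (p.eps (ev (X.rho K) x) (ev (Y.s K) x) - p.eps (ev (X.rho K) x) (ev (X.s K) x))) with hS
  have hSc (K) : ContinuousOn (S K) (M.cell K) :=
    continuousOn_const.mul (((c22 K).sub (c21 K)).add ((c12 K).sub (c11 K)))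
  have hT : M.ip Z.T (Y.s - X.s) = M.int S := by
    rw [h.T_eq _ (h.mem_s.2.sub h.mem_s.1)]
    congr 1; funext K x
    rw [Pi.sub_apply, ev_sub, deltaS_mul]
  have hθ : M.ip Z.theta (Y.rho - X.rho) = M.int (fun K x =>
      1 / 2 * inner ℝ (evv (M.smul (Y.rho - X.rho) X.u K) x) (evv (Y.u K) x)
        - ((p.eps (ev (Y.rho K) x) (ev (Y.s K) x) - p.eps (ev (X.rho K) x) (ev (X.s K) x))
          - S K x)) := by
    rw [h.theta_eq _ (h.mem_rho.2.sub h.mem_rho.1)]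
    congr 1; funext K x
    have e1 : evv (M.smul (Y.rho - X.rho) X.u K) x
        = (ev (Y.rho K) x - ev (X.rho K) x) • evv (X.u K) x := by
      ext i; simp [smul]
    have e2 := deltaRho_mul_add_deltaS_mul p.eps (ev (X.rho K) x) (ev (Y.rho K) x)
      (ev (X.s K) x) (ev (Y.s K) x)
    rw [deltaS_mul] at e2
    rw [e1, inner_smul_left, conj_trivial, Pi.sub_apply, ev_sub]
    linear_combination -e2
  rw [int_sub (f := fun K x => _ * _) (g := fun K x => _ - _ - _) _
      (fun K => (continuous_const.mul ((continuous_evv _).inner (continuous_evv _))).continuousOn)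
      (fun K => ((c22 K).sub (c11 K)).sub (hSc K)),
    int_sub (f := fun K x => _ - _) _ (fun K => (c22 K).sub (c11 K)) hSc,
    int_sub _ c22 c11, int_const_mul] at hθ
  rw [hT, hθ, ipv]
  ring

/-- The time derivative of the kinetic energy, in the form in which the momentum and the density
equation produce it. -/
lemma kinetic_identity (X Y : M.State) :
    M.ipv (M.smul Y.rho Y.u - M.smul X.rho X.u) (mid X.u Y.u)
      = 1 / 2 * M.ipv (M.smul Y.rho Y.u) Y.u - 1 / 2 * M.ipv (M.smul X.rho X.u) X.u
        + 1 / 2 * M.ipv (M.smul (Y.rho - X.rho) X.u) Y.u := by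
  have e1 : M.smul (Y.rho - X.rho) X.u = M.smul Y.rho X.u - M.smul X.rho X.u :=
    funext fun K => by simp [smul, sub_smul]
  have e2 (f : M.Scal) (u v : M.Vec) : M.ipv (M.smul f u) v = M.ipv (M.smul f v) u := by
    rw [ipv_eq, ipv_eq]
    congr 1; funext K
    simp only [pdot, smul, Pi.smul_apply, smul_eq_mul]
    exact Finset.sum_congr rfl fun i _ => by ring
  rw [e1, mid, ipv_smul_right, ipv_add_right]
  simp only [ipv_sub_left]
  rw [e2 Y.rho X.u Y.u]
  ring

lemma aForm_self (w u : M.Vec) : M.aForm w u u = 0 := by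
  simp only [aForm, bracket_self, ipv_eq]
  simp only [pdot, Pi.zero_apply, mul_zero, Finset.sum_const_zero]
  exact neg_eq_zero.2 (map_zero M.polyInt)

/-- Testing the momentum equation with `u`, the density equation with `θ`, the induction equation
with `B / μ₀` and the entropy equation with `1`, and adding up. -/
lemma IsStep.energy_balance {I J : Set ℝ}
    (hε : ContinuousOn (fun z : ℝ × ℝ => p.eps z.1 z.2) (I ×ˢ J))
    (hX : ∀ K, ∀ x ∈ M.cell K, ev (X.rho K) x ∈ I ∧ ev (X.s K) x ∈ J)
    (hY : ∀ K, ∀ x ∈ M.cell K, ev (Y.rho K) x ∈ I ∧ ev (Y.s K) x ∈ J)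
    (h : M.IsStep r q p α dt X Y Z) :
    (M.energy p Y - M.energy p X) / dt = -M.eForm p 1 Z.T := by
  have hmom := h.momentum _ (h.mem_u.1.mid h.mem_u.2)
  have hden := h.density _ h.mem_theta
  have hind := h.induction _ (h.mem_B.1.mid h.mem_B.2)
  have hent := h.entropy 1 (MemDG.one q)
  have hmag := h.ipv_curl_E
  have hJJ := h.J_eq _ h.mem_J
  have hint := h.internal_energy hε hX hY
  have hkin := kinetic_identity X Y
  have hJ1 : M.int (fun K x => ev ((1 : M.Scal) K) x * ev (pdot (Z.J K) (Z.J K)) x)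
      = M.ipv Z.J Z.J := by
    rw [ipv]
    congr 1; funext K x
    rw [inner_evv]; simp
  have hB : M.ipv (Y.B - X.B) (mid X.B Y.B) = 1 / 2 * (M.ipv Y.B Y.B - M.ipv X.B X.B) := by
    rw [mid, ipv_smul_right, ipv_add_right, ipv_sub_left, ipv_sub_left, M.ipv_comm Y.B X.B]
    ring
  rw [entropyLHS, entropyRHS, hJ1, mul_one, hForm_smul, ip_smul_left, M.ip_comm _ Z.T] at hent
  rw [aForm_self, ipv_smul_left, hkin] at hmom
  rw [ip_smul_left, M.ip_comm _ Z.theta] at hden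
  rw [ipv_smul_left, hB] at hind
  rw [M.ipv_comm _ (M.curl Z.J)] at hJJ
  rw [energy_eq hε hX, energy_eq hε hY, div_eq_inv_mul]
  have hmu : 1 / (2 * p.mu0) = p.mu0⁻¹ * (1 / 2) := by rw [one_div, mul_inv]; ring
  rw [hmu]
  -- the advection terms `b1` of the three equations and the viscous and Joule heating cancel here
  linear_combination dt⁻¹ * hint + hmom - hden + p.mu0⁻¹ * hind + hent - hmag + p.nu * hJJ

end Step

/-! ### The Second Law -/

/-- The deviatoric part of the rate of strain and the bulk viscosity both dissipate. -/
lemma ev_stressGrad_self_nonneg (p : Params) (u : VPoly) (x : E3) :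
    0 ≤ ev (stressGrad p.mu p.lam u u) x := by
  have hmu := p.mu_nonneg
  have hbulk := p.bulk_nonneg
  set g : Fin 3 → Fin 3 → ℝ := fun i j => ev (MvPolynomial.pderiv j (u i)) x with hg
  have e : ev (stressGrad p.mu p.lam u u) x
      = p.mu * ((g 0 1 + g 1 0) ^ 2 + (g 0 2 + g 2 0) ^ 2 + (g 1 2 + g 2 1) ^ 2
          + 2 / 3 * ((g 0 0 - g 1 1) ^ 2 + (g 0 0 - g 2 2) ^ 2 + (g 1 1 - g 2 2) ^ 2))
        + (p.lam + 2 / 3 * p.mu) * (g 0 0 + g 1 1 + g 2 2) ^ 2 := by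
    simp only [stressGrad, stress, pdiv, Fin.sum_univ_three, ev_add, ev_mul, ev_C, hg]
    simp
    ring
  rw [e]
  positivity

lemma cForm_self_nonneg (p : Params) {w : M.Scal} (hw : ∀ K, ∀ x ∈ M.cell K, 0 ≤ ev (w K) x)
    (u : M.Vec) : 0 ≤ M.cForm p w u u :=
  M.int_nonneg fun K x hx => mul_nonneg (hw K x hx) (ev_stressGrad_self_nonneg p (u K) x)

/-- The two consistency terms of the interior penalty form cancel on the diagonal. -/
lemma dN_self_nonpos (p : Params) {w f : M.Scal} (hf : ∀ K, ∀ x ∈ M.cell K, 0 < ev (f K) x)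
    (hw : ∀ K, ∀ x ∈ M.cell K, 0 ≤ ev (w K) x) : M.dN p w f f ≤ 0 := by
  have h1 : 0 ≤ M.int (fun K x => ev (w K) x / ev (f K) x * p.kappa *
      inner ℝ (evv (pgrad (f K)) x) (evv (pgrad (f K)) x)) :=
    M.int_nonneg fun K x hx => mul_nonneg
      (mul_nonneg (div_nonneg (hw K x hx) (hf K x hx).le) p.kappa_nonneg) real_inner_self_nonneg
  have h2 : 0 ≤ M.intInterior (fun F G x => p.eta / M.hsize F *
      (M.avg (M.val w) F G x / M.avg (M.val f) F G x *
        inner ℝ (M.jump (M.val f) F G x) (M.jump (M.val f) F G x))) := by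
    refine Finset.sum_nonneg fun e he => setIntegral_nonneg (M.measurableSet_side _) fun x hx => ?_
    simp only [interiorFaces, Finset.mem_filter] at he
    have hx1 : x ∈ M.cell e.1.1 := M.side_subset_cell _ hx
    have hx2 : x ∈ M.cell e.2.1 := M.side_subset_cell e.2 (by rwa [side, ← he.2.2])
    have a1 : 0 ≤ M.avg (M.val w) e.1 e.2 x :=
      mul_nonneg (by norm_num) (add_nonneg (hw _ x hx1) (hw _ x hx2))
    have a2 : 0 ≤ M.avg (M.val f) e.1 e.2 x :=
      mul_nonneg (by norm_num) (add_nonneg (hf _ x hx1).le (hf _ x hx2).le)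
    exact mul_nonneg (div_nonneg p.eta_nonneg Metric.diam_nonneg)
      (mul_nonneg (div_nonneg a1 a2) real_inner_self_nonneg)
  rw [dN]
  linarith

lemma intBoundary_eq_zero {g : M.Side → E3 → ℝ} (h : ∀ F ∈ M.boundaryFaces, ∀ x, g F x = 0) :
    M.intBoundary g = 0 :=
  Finset.sum_eq_zero fun F hF => by simp [h F hF]

lemma dForm_eq_dN {p : Params} {w : M.Scal}
    (h : p.bc = ThermalBC.neumann ∨ ∀ F ∈ M.boundaryFaces, w F.1 = 0) (f g : M.Scal) :
    M.dForm p w f g = M.dN p w f g := by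
  rcases h with h | h
  · simp [dForm, h]
  · unfold dForm
    split
    · rfl
    · rw [intBoundary_eq_zero fun F hF x => by simp [h F hF], add_zero]
    · rw [intBoundary_eq_zero fun F hF x => by simp [h F hF],
        intBoundary_eq_zero fun F hF x => by simp [h F hF], add_zero, sub_zero]

lemma eForm_eq_zero {p : Params} {w : M.Scal}
    (h : p.bc = ThermalBC.neumann ∨ ∀ F ∈ M.boundaryFaces, w F.1 = 0) (f : M.Scal) :
    M.eForm p w f = 0 := by
  rcases h with h | h
  · simp [eForm, h]
  · unfold eForm
    split
    · rfl
    · exact intBoundary_eq_zero fun F hF x => by simp [h F hF]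
    · rw [intBoundary_eq_zero fun F hF x => by simp [h F hF],
        intBoundary_eq_zero fun F hF x => by simp [h F hF], add_zero, neg_zero]

lemma nu_mul_int_nonneg (p : Params) {w : M.Scal} (hw : ∀ K, ∀ x ∈ M.cell K, 0 ≤ ev (w K) x)
    (v : M.Vec) : 0 ≤ p.nu * M.int (fun K x => ev (w K) x * ev (pdot (v K) (v K)) x) :=
  mul_nonneg p.nu_nonneg <| M.int_nonneg fun K x hx => mul_nonneg (hw K x hx) <| by
    rw [← inner_evv]; exact real_inner_self_nonneg

end Mesh
end MHD

/-! ### Derivatives of broken polynomials as weak derivatives -/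

namespace MHD

lemma hasFDerivAt_ev (p : Poly) (x : E3) :
    HasFDerivAt (ev p) (∑ j, ev (MvPolynomial.pderiv j p) x •
      (EuclideanSpace.proj j : E3 →L[ℝ] ℝ)) x := by
  induction p using MvPolynomial.induction_on with
  | C a =>
    have : ev (MvPolynomial.C a) = fun _ => a := funext fun x => ev_C a x
    simpa [this] using hasFDerivAt_const a x
  | add p q hp hq =>
    have : ev (p + q) = ev p + ev q := funext fun x => ev_add p q x
    rw [this]
    refine (hp.add hq).congr_fderiv ?_
    simp [add_smul, Finset.sum_add_distrib]
  | mul_X p n hp =>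
    have : ev (p * MvPolynomial.X n) = ev p * (EuclideanSpace.proj n : E3 →L[ℝ] ℝ) := by
      funext x; simp [ev]
    rw [this]
    refine (hp.mul (EuclideanSpace.proj n : E3 →L[ℝ] ℝ).hasFDerivAt).congr_fderiv ?_
    have hX : ev (MvPolynomial.X n) x = x n := by simp [ev]
    simp only [MvPolynomial.pderiv_mul, MvPolynomial.pderiv_X, ev_add, ev_mul, add_smul,
      Finset.sum_add_distrib, hX, Finset.smul_sum, smul_smul, PiLp.proj_apply]
    rw [add_comm]
    congr 1
    · exact Finset.sum_congr rfl fun j _ => by rw [mul_comm]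
    · symm
      rw [Finset.sum_eq_single n]
      · simp
      · intro j _ hj
        simp [hj.symm]
      · simp

lemma fderiv_ev (p : Poly) (x : E3) (j : Fin 3) :
    fderiv ℝ (ev p) x (EuclideanSpace.single j 1) = ev (MvPolynomial.pderiv j p) x := by
  rw [(hasFDerivAt_ev p x).fderiv]
  simp

lemma fderiv_ofLp_apply {φ : E3 → E3} (hφ : Differentiable ℝ φ) (x v : E3) (i : Fin 3) :
    fderiv ℝ φ x v i = fderiv ℝ (fun y => φ y i) x v := by
  have := ((EuclideanSpace.proj i : E3 →L[ℝ] ℝ).hasFDerivAt.comp x (hφ x).hasFDerivAt).fderiv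
  change _ = fderiv ℝ ((EuclideanSpace.proj i : E3 →L[ℝ] ℝ) ∘ φ) x v
  rw [this]; rfl

/-- `∂ⱼ (p ψ)`, whose integral vanishes for a test function `ψ`. -/
noncomputable def pderivMul (j : Fin 3) (p : Poly) (ψ : E3 → ℝ) (x : E3) : ℝ :=
  ev p x * fderiv ℝ ψ x (EuclideanSpace.single j 1) + ev (MvPolynomial.pderiv j p) x * ψ x

section pderivMul

variable (j : Fin 3) (p : Poly) {ψ : E3 → ℝ} (hψ : ContDiff ℝ ∞ ψ) (hc : HasCompactSupport ψ)
include hψ hc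

lemma integrable_ev_mul_fderiv :
    Integrable fun x => ev p x * fderiv ℝ ψ x (EuclideanSpace.single j 1) :=
  ((continuous_ev p).mul ((hψ.continuous_fderiv (by simp)).clm_apply
    continuous_const)).integrable_of_hasCompactSupport
      ((hc.fderiv_apply ℝ (EuclideanSpace.single j 1)).mul_left)

lemma integrable_ev_mul : Integrable fun x => ev p x * ψ x :=
  ((continuous_ev p).mul hψ.continuous).integrable_of_hasCompactSupport hc.mul_left

lemma integrable_pderivMul : Integrable (pderivMul j p ψ) :=
  (integrable_ev_mul_fderiv j p hψ hc).add (integrable_ev_mul _ hψ hc)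

lemma integral_pderivMul : ∫ x, pderivMul j p ψ x = 0 := by
  simp only [pderivMul]
  rw [integral_add (integrable_ev_mul_fderiv j p hψ hc) (integrable_ev_mul _ hψ hc),
    integral_mul_fderiv_eq_neg_fderiv_mul_of_integrable]
  · simp only [fderiv_ev]; ring
  · simp only [fderiv_ev]
    exact integrable_ev_mul _ hψ hc
  · exact integrable_ev_mul_fderiv j p hψ hc
  · exact integrable_ev_mul _ hψ hc
  · exact fun x _ => (hasFDerivAt_ev p x).differentiableAt
  · exact fun x _ => (hψ.differentiable (by simp)) x

end pderivMul

lemma integrable_inner_evv (v : VPoly) {φ : E3 → E3} (hφ : Continuous φ)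
    (hc : HasCompactSupport φ) : Integrable fun x => inner ℝ (evv v x) (φ x) := by
  refine ((continuous_evv v).inner hφ).integrable_of_hasCompactSupport ?_
  exact hc.mono fun x hx => by contrapose! hx; simp_all

lemma integral_inner_curlE (v : VPoly) {φ : E3 → E3} (hφ : ContDiff ℝ ∞ φ)
    (hc : HasCompactSupport φ) :
    ∫ x, inner ℝ (evv v x) (curlE φ x) = ∫ x, inner ℝ (evv (pcurl v) x) (φ x) := by
  have hφi (i : Fin 3) : ContDiff ℝ ∞ fun x => φ x i :=
    (EuclideanSpace.proj i : E3 →L[ℝ] ℝ).contDiff.comp hφ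
  have hci (i : Fin 3) : HasCompactSupport fun x => φ x i :=
    hc.comp_left (g := fun y : E3 => y i) rfl
  have hd := hφ.differentiable (by simp)
  have hI (j i k : Fin 3) := integrable_pderivMul j (v i) (hφi k) (hci k)
  have h0 (j i k : Fin 3) := integral_pderivMul j (v i) (hφi k) (hci k)
  rw [← sub_eq_zero, ← integral_sub
    (integrable_inner_evv v (continuous_curlE hφ) (hasCompactSupport_curlE hc))
    (integrable_inner_evv (pcurl v) hφ.continuous hc)]
  have e : (fun x => inner ℝ (evv v x) (curlE φ x) - inner ℝ (evv (pcurl v) x) (φ x)) =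
      (pderivMul 1 (v 0) (fun x => φ x 2) - pderivMul 2 (v 0) (fun x => φ x 1))
        + (pderivMul 2 (v 1) (fun x => φ x 0) - pderivMul 0 (v 1) (fun x => φ x 2))
        + (pderivMul 0 (v 2) (fun x => φ x 1) - pderivMul 1 (v 2) (fun x => φ x 0)) := by
    funext x
    simp only [PiLp.inner_apply, Fin.sum_univ_three, curlE, pcurl, evv_apply, pderivMul,
      fderiv_ofLp_apply hd, RCLike.inner_apply, conj_trivial, Pi.add_apply, Pi.sub_apply]
    simp
    ring
  have hs (j i k j' i' k' : Fin 3) := (hI j i k).sub (hI j' i' k')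
  rw [e, integral_add' ((hs _ _ _ _ _ _).add (hs _ _ _ _ _ _)) (hs _ _ _ _ _ _),
    integral_add' (hs _ _ _ _ _ _) (hs _ _ _ _ _ _),
    integral_sub' (hI _ _ _) (hI _ _ _), integral_sub' (hI _ _ _) (hI _ _ _),
    integral_sub' (hI _ _ _) (hI _ _ _)]
  simp [h0]

lemma gradient_apply (φ : E3 → ℝ) (x : E3) (i : Fin 3) :
    gradient φ x i = fderiv ℝ φ x (EuclideanSpace.single i 1) := by
  rw [← InnerProductSpace.toDual_symm_apply (𝕜 := ℝ) (y := fderiv ℝ φ x),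
    EuclideanSpace.inner_single_right]
  simp [gradient]

lemma contDiff_gradient {φ : E3 → ℝ} (hφ : ContDiff ℝ ∞ φ) : ContDiff ℝ ∞ (gradient φ) :=
  (InnerProductSpace.toDual ℝ E3).symm.toContinuousLinearEquiv.contDiff.comp
    (hφ.fderiv_right (m := ∞) (by simp))

lemma curlE_gradient {φ : E3 → ℝ} (hφ : ContDiff ℝ ∞ φ) (x : E3) :
    curlE (gradient φ) x = 0 := by
  have hd : Differentiable ℝ (fderiv ℝ φ) :=
    (hφ.fderiv_right (m := ∞) (by simp)).differentiable (by simp)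
  have hsymm : IsSymmSndFDerivAt ℝ φ x := hφ.contDiffAt.isSymmSndFDerivAt (by
    rw [minSmoothness_of_isRCLikeNormedField]; exact WithTop.coe_le_coe.2 (le_top : (2 : ℕ∞) ≤ ⊤))
  have key (i j : Fin 3) : fderiv ℝ (gradient φ) x (EuclideanSpace.single j 1) i
      = fderiv ℝ (fderiv ℝ φ) x (EuclideanSpace.single j 1) (EuclideanSpace.single i 1) := by
    rw [fderiv_ofLp_apply ((contDiff_gradient hφ).differentiable (by simp))]
    simp only [gradient_apply]
    rw [fderiv_clm_apply (hd x) (differentiableAt_const _)]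
    simp
  ext i
  fin_cases i <;> simp [curlE, key] <;> rw [sub_eq_zero] <;> exact hsymm.eq _ _

/-- A curl is divergence free, up to the boundary. -/
lemma HasCurl₀.hasDiv₀_zero {Ω : Set E3} {A C : E3 → E3} (h : HasCurl₀ Ω A C) :
    HasDiv₀ Ω C 0 := by
  refine ⟨h.2.1, MemLp.zero, fun φ hφ hc => ?_⟩
  rw [← h.2.2 _ (contDiff_gradient hφ) (hasCompactSupport_gradient hc)]
  simp [curlE_gradient hφ]

lemma HasCurl₀.congr {Ω : Set E3} {A C C' : E3 → E3} (h : HasCurl₀ Ω A C)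
    (hC : C =ᵐ[volume.restrict Ω] C') : HasCurl₀ Ω A C' := by
  refine ⟨h.1, (memLp_congr_ae hC).1 h.2.1, fun φ hφ hc => ?_⟩
  rw [h.2.2 φ hφ hc]
  refine integral_congr_ae ?_
  filter_upwards [hC] with x hx
  rw [hx]

lemma degLE_pderiv {d : ℕ} {p : Poly} (i : Fin 3) (hp : DegLE d p) :
    DegLE d (MvPolynomial.pderiv i p) := by
  refine le_trans ?_ hp
  refine Finset.sup_le fun m hm => ?_
  rw [MvPolynomial.mem_support_iff, MvPolynomial.coeff_pderiv] at hm
  have h1 : m + Finsupp.single i 1 ∈ p.support :=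
    MvPolynomial.mem_support_iff.2 (left_ne_zero_of_mul hm)
  refine le_trans ?_ (MvPolynomial.le_totalDegree h1)
  rw [Finsupp.sum_add_index' (fun _ => rfl) (fun _ _ _ => rfl)]
  exact Nat.le_add_right _ _

lemma degLE_X_mul_pderiv {d : ℕ} {p : Poly} (i : Fin 3) (hp : DegLE d p) :
    DegLE d (MvPolynomial.X i * MvPolynomial.pderiv i p) := by
  refine le_trans (MvPolynomial.totalDegree_le_of_support_subset fun m hm => ?_) hp
  rw [MvPolynomial.mem_support_iff, MvPolynomial.coeff_X_mul'] at hm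
  split_ifs at hm with h
  · rw [MvPolynomial.coeff_pderiv] at hm
    have : m - Finsupp.single i 1 + Finsupp.single i 1 = m :=
      tsub_add_cancel_of_le (Finsupp.single_le_iff.2
        (Nat.one_le_iff_ne_zero.2 (Finsupp.mem_support_iff.1 h)))
    rw [this] at hm
    exact MvPolynomial.mem_support_iff.2 (left_ne_zero_of_mul hm)
  · exact absurd rfl hm

lemma DegLE.sub {d : ℕ} {p q : Poly} (hp : DegLE d p) (hq : DegLE d q) : DegLE d (p - q) := by
  simpa [sub_eq_add_neg] using hp.add (hq.smul (-1))

lemma degLE_sum {d : ℕ} {p : Fin 3 → Poly} (hp : ∀ i, DegLE d (p i)) : DegLE d (∑ i, p i) :=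
  MvPolynomial.totalDegree_finsetSum_le fun i _ => hp i

/-- `curl (x × q) = (div q) x - 2 q - (x · ∇) q`. -/
lemma pcurl_posField_cross (q : VPoly) :
    pcurl (posField ⨯₃ q) = (fun i => (-2 : ℝ) • q i - ∑ j, MvPolynomial.X j *
      MvPolynomial.pderiv j (q i)) + pdiv q • posField := by
  ext1 i
  have h (i j : Fin 3) : MvPolynomial.pderiv i (MvPolynomial.X j : Poly)
      = if i = j then 1 else 0 := by
    rw [MvPolynomial.pderiv_X, Pi.single_apply]; simp [eq_comm]
  have hC : (MvPolynomial.C 2 : Poly) = 2 := map_ofNat _ 2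
  fin_cases i <;>
    simp [pcurl, cross_apply, posField, pdiv, Fin.sum_univ_three, h, hC,
      MvPolynomial.smul_eq_C_mul] <;> ring

lemma degLE_pcurl {d : ℕ} {v : VPoly} (hv : ∀ i, DegLE d (v i)) (i : Fin 3) :
    DegLE d (pcurl v i) := by
  fin_cases i <;> exact (degLE_pderiv _ (hv _)).sub (degLE_pderiv _ (hv _))

namespace Mesh

variable {M : Mesh}

/-- The weak curl of a broken polynomial field in `H₀(curl)` is its cellwise curl. -/
lemma _root_.MHD.HasCurl₀.toFun_curl {v : M.Vec} {C : E3 → E3}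
    (h : HasCurl₀ M.dom (M.toFun v) C) : HasCurl₀ M.dom (M.toFun v) (M.toFun (M.curl v)) := by
  refine h.congr ?_
  rw [Filter.EventuallyEq, volume_restrict_dom, ae_finsetSum_measure_iff]
  intro K _
  rw [← Measure.restrict_congr_set (M.interior_cell_ae_eq K),
    ae_restrict_iff' isOpen_interior.measurableSet]
  have hloc : LocallyIntegrableOn (fun x => C x - evv (pcurl (v K)) x)
      (interior (M.cell K)) := by
    refine LocallyIntegrableOn.sub ?_ ((continuous_evv _).locallyIntegrable.locallyIntegrableOn _)
    have : LocallyIntegrableOn C M.dom :=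
      locallyIntegrableOn_of_locallyIntegrable_restrict
        (h.2.1.locallyIntegrable (by norm_num))
    exact this.mono_set (M.interior_cell_subset_dom K)
  have key := isOpen_interior.ae_eq_zero_of_integral_contDiff_smul_eq_zero hloc ?_
  · filter_upwards [key] with x hx hxK
    rw [M.toFun_of_mem_interior _ hxK]
    exact sub_eq_zero.1 (hx hxK)
  intro g hg hgc hgs
  have hz {x : E3} (hx : x ∉ interior (M.cell K)) : g x = 0 :=
    image_eq_zero_of_notMem_tsupport fun h => hx (hgs h)
  -- argue by contradiction, since a nonzero integral is the integral of an integrable function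
  by_contra hne
  refine hne (ext_inner_right ℝ fun a => ?_)
  rw [inner_zero_left]
  set φ : E3 → E3 := fun x => g x • a
  have hφ : ContDiff ℝ ∞ φ := hg.smul contDiff_const
  have hφc : HasCompactSupport φ := hgc.smul_right
  have hφz {x : E3} (hx : x ∉ interior (M.cell K)) : φ x = 0 := by simp [φ, hz hx]
  have hcz {x : E3} (hx : x ∉ interior (M.cell K)) : curlE φ x = 0 := by
    have hx' : x ∉ tsupport φ := fun h => hx (hgs (tsupport_smul_subset_left g _ h))
    have : fderiv ℝ φ x = 0 :=
      image_eq_zero_of_notMem_tsupport fun h => hx' (tsupport_fderiv_subset ℝ h)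
    ext i; fin_cases i <;> simp [curlE, this]
  have hsub := M.interior_cell_subset_dom K
  have e1 : ∫ x in M.dom, inner ℝ (M.toFun v x) (curlE φ x)
      = ∫ x, inner ℝ (evv (v K) x) (curlE φ x) := by
    rw [setIntegral_eq_integral_of_forall_compl_eq_zero
      fun x hx => by rw [hcz fun h => hx (hsub h), inner_zero_right]]
    refine integral_congr_ae (.of_forall fun x => ?_)
    by_cases hx : x ∈ interior (M.cell K)
    · simp only [M.toFun_of_mem_interior v hx]
    · simp only [hcz hx, inner_zero_right]
  have e2 : ∫ x in M.dom, inner ℝ (C x) (φ x) = ∫ x, inner ℝ (C x) (φ x) :=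
    setIntegral_eq_integral_of_forall_compl_eq_zero
      fun x hx => by rw [hφz fun h => hx (hsub h), inner_zero_right]
  have hCi : Integrable fun x => inner ℝ (C x) (φ x) := by
    refine (integrableOn_iff_integrable_of_support_subset (s := M.dom) fun x hx => ?_).1
      (integrable_inner_of_memLp h.2.1 hφ.continuous hφc)
    by_contra hxd
    exact hx (by simp [hφz fun h => hxd (hsub h)])
  have hPi := integrable_inner_evv (pcurl (v K)) hφ.continuous hφc
  have e3 := h.2.2 φ hφ hφc
  rw [e1, e2, integral_inner_curlE _ hφ hφc] at e3
  have hgi : Integrable fun x => g x • (C x - evv (pcurl (v K)) x) := by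
    by_contra hni
    exact hne (integral_undef hni)
  rw [real_inner_comm, ← integral_inner hgi]
  have e4 : (fun x => inner ℝ a (g x • (C x - evv (pcurl (v K)) x)))
      = fun x => inner ℝ (C x) (φ x) - inner ℝ (evv (pcurl (v K)) x) (φ x) := by
    funext x
    simp only [φ, inner_smul_right, inner_sub_right, real_inner_comm a]
    ring
  rw [e4, integral_sub hCi hPi, e3, sub_self]

lemma MemNED.hasCurl₀ {r : ℕ} {v : M.Vec} (hv : M.MemNED r v) :
    HasCurl₀ M.dom (M.toFun v) (M.toFun (M.curl v)) := by
  obtain ⟨C, hC⟩ := hv.2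
  exact hC.toFun_curl

/-- The link `curl U_h^curl ⊆ U_h^div` of the discrete de Rham complex. -/
lemma MemNED.memRT_curl {r : ℕ} {v : M.Vec} (hv : M.MemNED r v) : M.MemRT r (M.curl v) := by
  refine ⟨fun K => ?_, 0, hv.hasCurl₀.hasDiv₀_zero⟩
  obtain ⟨p, q, hp, hq, h⟩ := hv.1 K
  refine ⟨pcurl p + fun i => (-2 : ℝ) • q i - ∑ j, MvPolynomial.X j *
      MvPolynomial.pderiv j (q i), pdiv q, fun i => ?_, ?_, ?_⟩
  · exact (degLE_pcurl hp i).add (((hq i).smul _).sub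
      (degLE_sum fun j => degLE_X_mul_pderiv j (hq i)))
  · exact degLE_sum fun i => degLE_pderiv i (hq i)
  · rw [curl, h, pcurl_add, pcurl_posField_cross, add_assoc]

section Step

variable {r q : ℕ} {p : Params} {α : Fin M.card → E3 → ℝ} {dt : ℝ} {X Y : M.State} {Z : M.Aux}

/-- The induction equation holds pointwise, since its residual lies in `U_h^div` and is
orthogonal to that space. -/
lemma IsStep.induction_pointwise (h : M.IsStep r q p α dt X Y Z)
    (h0 : ∀ C, M.MemRT r C → M.hForm α 1 Z.T C = 0) :
    dt⁻¹ • (Y.B - X.B) + M.curl Z.E = -p.nu • M.curl Z.J := by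
  set R := dt⁻¹ • (Y.B - X.B) + M.curl Z.E - -p.nu • M.curl Z.J with hR
  have hmem : M.MemRT r R :=
    (((h.mem_B.2.sub h.mem_B.1).smul _).add h.mem_E.memRT_curl).sub (h.mem_J.memRT_curl.smul _)
  have hz : M.ipv R R = 0 := by
    have := h.induction R hmem
    rw [h0 R hmem] at this
    conv_lhs => rw [hR]
    rw [ipv_sub_left, ipv_add_left, ipv_smul_left (c := -p.nu), this]
    ring
  exact sub_eq_zero.1 (M.eq_zero_of_ipv_self R hz)

lemma IsStep.div_eq (h : M.IsStep r q p α dt X Y Z) (hdt : dt ≠ 0)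
    (h0 : ∀ C, M.MemRT r C → M.hForm α 1 Z.T C = 0) : M.div Y.B = M.div X.B := by
  have hp := h.induction_pointwise h0
  funext K
  have hK := congrArg pdiv (congrFun hp K)
  simp only [Pi.add_apply, Pi.smul_apply, Pi.sub_apply, curl, pdiv_add, pdiv_smul, pdiv_pcurl,
    smul_zero, add_zero, sub_eq_add_neg (Y.B K), ← neg_one_smul ℝ (X.B K)] at hK
  have := (smul_eq_zero.1 hK).resolve_left (inv_ne_zero hdt)
  rw [neg_one_smul] at this
  exact add_neg_eq_zero.1 this

end Step

end Mesh
end MHD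

/-! ### Symmetry of the curl on `H₀(curl)` -/

namespace MHD

/-- The mollified pairing `∫∫ k(x - z) f(x) g(z) dz dx` of two functions. -/
noncomputable def mollPair (k f g : E3 → ℝ) : ℝ := ∫ x, ∫ z, k (x - z) * (f x * g z)

/-- The cross-correlation of two functions, at the shift `y`. -/
noncomputable def crossCorr (f g : E3 → ℝ) (y : E3) : ℝ := ∫ x, f x * g (x - y)

lemma abs_mul_mul_le (c a b : ℝ) : |c * (a * b)| ≤ a ^ 2 * |c| + |c| * b ^ 2 := by
  rw [abs_mul, abs_mul]
  have : |a| * |b| ≤ a ^ 2 + b ^ 2 := by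
    nlinarith [sq_abs a, sq_abs b, sq_nonneg (|a| - |b|), sq_nonneg a, sq_nonneg b]
  nlinarith [mul_le_mul_of_nonneg_left this (abs_nonneg c)]

section Kernel

variable {k f g : E3 → ℝ} (hk : Continuous k) (hc : HasCompactSupport k)
  (hf : MemLp f 2) (hg : MemLp g 2)
include hk hc hf hg

lemma integrable_mollPair :
    Integrable (fun p : E3 × E3 => k (p.1 - p.2) * (f p.1 * g p.2)) (volume.prod volume) := by
  have hk' : Continuous fun x => |k (-x)| := (hk.comp continuous_neg).abs
  have hc' : HasCompactSupport fun x => |k (-x)| :=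
    (hc.comp_homeomorph (Homeomorph.neg E3)).comp_left (g := fun t : ℝ => |t|) abs_zero
  have b1 := (hf.integrable_sq.convolution_integrand (ContinuousLinearMap.mul ℝ ℝ)
    (hk'.integrable_of_hasCompactSupport (μ := volume) hc')).swap
  have b2 := hg.integrable_sq.convolution_integrand (ContinuousLinearMap.mul ℝ ℝ)
    (hk.abs.integrable_of_hasCompactSupport (μ := volume)
      (hc.comp_left (g := fun t : ℝ => |t|) abs_zero))
  refine (b1.add b2).mono ?_ (.of_forall fun p => ?_)
  · exact (hk.comp (continuous_fst.sub continuous_snd)).aestronglyMeasurable.mul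
      (hf.1.comp_fst.mul hg.1.comp_snd)
  · simp only [Function.comp_apply, Prod.swap, ContinuousLinearMap.mul_apply', Pi.add_apply,
      neg_sub, Real.norm_eq_abs]
    rw [mul_comm (g p.2 ^ 2)]
    exact (abs_mul_mul_le _ _ _).trans (le_abs_self _)

lemma integrable_shifted :
    Integrable (fun p : E3 × E3 => k p.2 * (f p.1 * g (p.1 - p.2))) (volume.prod volume) := by
  have hka : Integrable fun x => |k x| := hk.abs.integrable_of_hasCompactSupport
    (hc.comp_left (g := fun t : ℝ => |t|) abs_zero)
  have b1 := hf.integrable_sq.mul_prod hka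
  have b2 := hka.convolution_integrand (ContinuousLinearMap.mul ℝ ℝ) hg.integrable_sq
  refine (b1.add b2).mono ?_ (.of_forall fun p => ?_)
  · exact (hk.comp continuous_snd).aestronglyMeasurable.mul (hf.1.comp_fst.mul
      (hg.1.comp_quasiMeasurePreserving
        (quasiMeasurePreserving_sub_of_right_invariant volume volume)))
  · simp only [ContinuousLinearMap.mul_apply', Pi.add_apply, Real.norm_eq_abs]
    exact (abs_mul_mul_le _ _ _).trans (le_abs_self _)

lemma mollPair_swap : mollPair k f g = ∫ z, ∫ x, k (x - z) * (f x * g z) :=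
  integral_integral_swap (integrable_mollPair hk hc hf hg)

lemma mollPair_comm : mollPair k f g = mollPair (fun y => k (-y)) g f := by
  rw [mollPair_swap hk hc hf hg, mollPair]
  simp only [neg_sub, mul_comm (f _)]

lemma mollPair_eq_integral_crossCorr : mollPair k f g = ∫ y, k y * crossCorr f g y := by
  have h (x : E3) : ∫ z, k (x - z) * (f x * g z) = ∫ y, k y * (f x * g (x - y)) := by
    rw [← integral_sub_left_eq_self (fun y => k y * (f x * g (x - y))) volume x]
    simp
  simp only [mollPair, h, crossCorr, ← integral_const_mul]
  exact integral_integral_swap (integrable_shifted hk hc hf hg)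

end Kernel

/-- Translations act continuously on `L²`. -/
lemma continuous_crossCorr {f g : E3 → ℝ} (hf : MemLp f 2) (hg : MemLp g 2) :
    Continuous (crossCorr f g) := by
  have hmp (y : E3) : MeasurePreserving (fun x : E3 => x - y) volume volume :=
    measurePreserving_sub_right volume y
  let T : E3 → C(E3, E3) := fun y => ⟨fun x => x - y, by fun_prop⟩
  have hT : Continuous T := ContinuousMap.continuous_of_continuous_uncurry _
    (continuous_snd.sub continuous_fst)
  have hcont : Continuous fun y => Lp.compMeasurePreserving (T y) (hmp y) (hg.toLp g) :=
    continuous_const.compMeasurePreservingLp hT hmp (by norm_num)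
  have e : crossCorr f g = fun y =>
      inner ℝ (hf.toLp f) (Lp.compMeasurePreserving (T y) (hmp y) (hg.toLp g)) := by
    funext y
    rw [L2.inner_def, crossCorr]
    refine integral_congr_ae ?_
    filter_upwards [hf.coeFn_toLp, Lp.coeFn_compMeasurePreserving (hg.toLp g) (hmp y),
      (hmp y).quasiMeasurePreserving.ae hg.coeFn_toLp] with x h1 h2 h3
    rw [h1]
    refine Eq.trans ?_ (congrArg (inner ℝ (f x)) h2.symm)
    simp [h3, mul_comm]
  rw [e]
  exact continuous_const.inner hcont

/-- The derivative of a test function, along a coordinate. -/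
noncomputable def testDeriv (j : Fin 3) (ψ : E3 → ℝ) (x : E3) : ℝ :=
  fderiv ℝ ψ x (EuclideanSpace.single j 1)

lemma continuous_testDeriv (j : Fin 3) {ψ : E3 → ℝ} (hψ : ContDiff ℝ ∞ ψ) :
    Continuous (testDeriv j ψ) :=
  (hψ.continuous_fderiv (by simp)).clm_apply continuous_const

lemma hasCompactSupport_testDeriv (j : Fin 3) {ψ : E3 → ℝ} (hc : HasCompactSupport ψ) :
    HasCompactSupport (testDeriv j ψ) := hc.fderiv_apply ℝ _

lemma testDeriv_comp_sub (j : Fin 3) (ψ : E3 → ℝ) (z x : E3) :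
    testDeriv j (fun x => ψ (x - z)) x = testDeriv j ψ (x - z) := by
  simp [testDeriv, fderiv_comp_sub]

lemma testDeriv_comp_neg (j : Fin 3) {ψ : E3 → ℝ} (hψ : Differentiable ℝ ψ) (x : E3) :
    testDeriv j (fun x => ψ (-x)) x = -testDeriv j ψ (-x) := by
  have := ((hψ (-x)).hasFDerivAt.comp x (hasFDerivAt_id x).neg).fderiv
  change fderiv ℝ (ψ ∘ Neg.neg) x _ = _
  rw [this]
  simp [testDeriv]

/-- One component of the weak curl, tested with translates of `η` and paired with `f`. -/
lemma mollPair_weakDeriv {A₁ A₂ C f η : E3 → ℝ} {a b : Fin 3} (h1 : MemLp A₁ 2) (h2 : MemLp A₂ 2)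
    (hC : MemLp C 2) (hf : MemLp f 2)
    (h : ∀ ψ : E3 → ℝ, ContDiff ℝ ∞ ψ → HasCompactSupport ψ →
      ∫ x, C x * ψ x = ∫ x, (A₁ x * testDeriv a ψ x - A₂ x * testDeriv b ψ x))
    (hη : ContDiff ℝ ∞ η) (hc : HasCompactSupport η) :
    mollPair η C f = mollPair (testDeriv a η) A₁ f - mollPair (testDeriv b η) A₂ f := by
  have ca := continuous_testDeriv a hη
  have cb := continuous_testDeriv b hη
  have sa := hasCompactSupport_testDeriv a hc
  have sb := hasCompactSupport_testDeriv b hc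
  rw [mollPair_swap hη.continuous hc hC hf, mollPair_swap ca sa h1 hf, mollPair_swap cb sb h2 hf,
    ← integral_sub (integrable_mollPair ca sa h1 hf).integral_prod_right
      (integrable_mollPair cb sb h2 hf).integral_prod_right]
  congr 1
  funext z
  have hs : HasCompactSupport fun x => η (x - z) :=
    hc.comp_homeomorph (Homeomorph.subRight z)
  have hz := h (fun x => η (x - z)) (hη.comp (contDiff_id.sub contDiff_const)) hs
  have hI {k A : E3 → ℝ} (hk : Continuous k) (hkc : HasCompactSupport k) (hA : MemLp A 2) :
      Integrable fun x => A x * k (x - z) :=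
    have hkz : MemLp (fun x => k (x - z)) 2 := (hk.comp
      (continuous_id.sub continuous_const)).memLp_of_hasCompactSupport
      (hkc.comp_homeomorph (Homeomorph.subRight z))
    hA.integrable_mul hkz
  simp only [testDeriv_comp_sub] at hz
  rw [integral_sub (hI ca sa h1) (hI cb sb h2)] at hz
  have e (k A : E3 → ℝ) : ∫ x, k (x - z) * (A x * f z) = (∫ x, A x * k (x - z)) * f z := by
    rw [← integral_mul_const]
    congr 1; funext x; ring
  rw [e, e, e, hz, sub_mul]

lemma HasCurl₀.indicator {Ω : Set E3} (hΩ : MeasurableSet Ω) {A C : E3 → E3}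
    (h : HasCurl₀ Ω A C) : HasCurl₀ Set.univ (Ω.indicator A) (Ω.indicator C) := by
  have hi (B φ : E3 → E3) : (fun x => inner ℝ (Ω.indicator B x) (φ x) : E3 → ℝ)
      = Ω.indicator fun x => inner ℝ (B x) (φ x) := by
    funext x
    by_cases hx : x ∈ Ω <;> simp [hx]
  refine ⟨?_, ?_, fun φ hφ hc => ?_⟩
  · rw [Measure.restrict_univ, memLp_indicator_iff_restrict hΩ]; exact h.1
  · rw [Measure.restrict_univ, memLp_indicator_iff_restrict hΩ]; exact h.2.1
  · simp only [hi, Measure.restrict_univ, integral_indicator hΩ]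
    exact h.2.2 φ hφ hc

/-- The components of a weak curl; indices are modulo `3`. -/
lemma HasCurl₀.component {A C : E3 → E3} (h : HasCurl₀ Set.univ A C) (i : Fin 3) {ψ : E3 → ℝ}
    (hψ : ContDiff ℝ ∞ ψ) (hc : HasCompactSupport ψ) :
    ∫ x, C x i * ψ x
      = ∫ x, (A x (i + 1) * testDeriv (i + 2) ψ x - A x (i + 2) * testDeriv (i + 1) ψ x) := by
  have hφ : ContDiff ℝ ∞ fun x => ψ x • EuclideanSpace.single i (1 : ℝ) := hψ.smul contDiff_const
  have hφc : HasCompactSupport fun x => ψ x • EuclideanSpace.single i (1 : ℝ) := hc.smul_right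
  have hw := h.2.2 _ hφ hφc
  rw [Measure.restrict_univ] at hw
  have e1 (x) : (inner ℝ (C x) (ψ x • EuclideanSpace.single i (1 : ℝ)) : ℝ) = C x i * ψ x := by
    rw [inner_smul_right, EuclideanSpace.inner_single_right]
    simp [mul_comm]
  have e2 (x) : (inner ℝ (A x) (curlE (fun x => ψ x • EuclideanSpace.single i (1 : ℝ)) x) : ℝ)
      = A x (i + 1) * testDeriv (i + 2) ψ x - A x (i + 2) * testDeriv (i + 1) ψ x := by
    have hd (v : E3) (l : Fin 3) :
        fderiv ℝ (fun x => ψ x • EuclideanSpace.single i (1 : ℝ)) x v l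
          = if l = i then fderiv ℝ ψ x v else 0 := by
      rw [fderiv_smul_const (hψ.differentiable (by simp) x)]
      simp
    simp only [PiLp.inner_apply, Fin.sum_univ_three, curlE, hd]
    fin_cases i <;> simp [testDeriv] <;> ring
  simp only [e1, e2] at hw
  exact hw.symm

/-- Fields in `H₀(curl)` can be integrated by parts without boundary term. Mollifying the
pairing with a test function makes both weak formulations applicable; the mollifier is removed by
the continuity of cross-correlations. -/
lemma HasCurl₀.integral_inner_comm_univ {A C A' C' : E3 → E3} (h : HasCurl₀ Set.univ A C)
    (h' : HasCurl₀ Set.univ A' C') :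
    ∫ x, inner ℝ (C x) (A' x) = ∫ x, inner ℝ (A x) (C' x) := by
  have hm {B : E3 → E3} (hB : MemLp B 2 (volume.restrict Set.univ)) (i : Fin 3) :
      MemLp (fun x => B x i) 2 := by
    rw [Measure.restrict_univ] at hB
    exact (EuclideanSpace.proj i : E3 →L[ℝ] ℝ).comp_memLp' hB
  have hA := hm h.1
  have hC := hm h.2.1
  have hA' := hm h'.1
  have hC' := hm h'.2.1
  set F : E3 → ℝ := fun y => ∑ i, crossCorr (fun x => C x i) (fun x => A' x i) y with hF
  set G : E3 → ℝ := fun y => ∑ i, crossCorr (fun x => A x i) (fun x => C' x i) y with hG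
  have hFc : Continuous F := continuous_finsetSum _ fun i _ => continuous_crossCorr (hC i) (hA' i)
  have hGc : Continuous G := continuous_finsetSum _ fun i _ => continuous_crossCorr (hA i) (hC' i)
  have hsum {f g : Fin 3 → E3 → ℝ} (hf : ∀ i, MemLp (f i) 2) (hg : ∀ i, MemLp (g i) 2)
      {η : E3 → ℝ} (hη : ContDiff ℝ ∞ η) (hc : HasCompactSupport η) :
      ∫ y, η y * ∑ i, crossCorr (f i) (g i) y = ∑ i, mollPair η (f i) (g i) := by
    simp only [Finset.mul_sum]
    rw [integral_finsetSum]
    · exact Finset.sum_congr rfl fun i _ =>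
        (mollPair_eq_integral_crossCorr hη.continuous hc (hf i) (hg i)).symm
    · exact fun i _ => (hη.continuous.mul
        (continuous_crossCorr (hf i) (hg i))).integrable_of_hasCompactSupport hc.mul_right
  have key : ∀ η : E3 → ℝ, ContDiff ℝ ∞ η → HasCompactSupport η →
      ∫ y, η y • F y = ∫ y, η y • G y := by
    intro η hη hc
    simp only [smul_eq_mul, hF, hG]
    rw [hsum hC hA' hη hc, hsum hA hC' hη hc]
    -- reflecting `η` exchanges the roles of the two fields and changes the sign of its derivatives
    have hηn : ContDiff ℝ ∞ fun y => η (-y) := hη.comp contDiff_neg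
    have hcn : HasCompactSupport fun y => η (-y) := hc.comp_homeomorph (Homeomorph.neg E3)
    have l1 (i : Fin 3) := mollPair_weakDeriv (hA (i + 1)) (hA (i + 2)) (hC i) (hA' i)
      (fun ψ h1 h2 => h.component i h1 h2) hη hc
    have l2 (i : Fin 3) : mollPair η (fun x => A x i) (fun x => C' x i)
        = mollPair (testDeriv (i + 1) η) (fun x => A x i) (fun x => A' x (i + 2))
          - mollPair (testDeriv (i + 2) η) (fun x => A x i) (fun x => A' x (i + 1)) := by
      have hneg (j l : Fin 3) : mollPair (testDeriv j fun y => η (-y)) (fun x => A' x l)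
          (fun x => A x i) = -mollPair (testDeriv j η) (fun x => A x i) (fun x => A' x l) := by
        rw [mollPair_comm (continuous_testDeriv j hη) (hasCompactSupport_testDeriv j hc) (hA i)
          (hA' l), mollPair, mollPair, ← integral_neg]
        congr 1; funext x
        rw [← integral_neg]
        congr 1; funext z
        rw [testDeriv_comp_neg j (hη.differentiable (by simp)), neg_mul]
      rw [mollPair_comm hη.continuous hc (hA i) (hC' i), mollPair_weakDeriv (hA' (i + 1))
        (hA' (i + 2)) (hC' i) (hA i) (fun ψ h1 h2 => h'.component i h1 h2) hηn hcn, hneg, hneg]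
      ring
    simp only [l1, l2, Fin.sum_univ_three]
    simp only [Fin.isValue, zero_add, Fin.reduceAdd]
    ring
  have hae := ae_eq_of_integral_contDiff_smul_eq hFc.locallyIntegrable hGc.locallyIntegrable key
  have h0 : F 0 = G 0 := congrFun ((hFc.ae_eq_iff_eq volume hGc).1 hae) 0
  have hz {f g : E3 → E3} (hf : ∀ i, MemLp (fun x => f x i) 2)
      (hg : ∀ i, MemLp (fun x => g x i) 2) : ∫ x, inner ℝ (f x) (g x)
        = ∑ i, crossCorr (fun x => f x i) (fun x => g x i) 0 := by
    simp only [crossCorr, sub_zero, PiLp.inner_apply, RCLike.inner_apply, conj_trivial]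
    rw [integral_finsetSum (f := fun i x => g x i * f x i) _
      fun i _ => (hg i).integrable_mul (hf i)]
    simp only [mul_comm]
  rw [hz hC hA', hz hA hC']
  exact h0

lemma HasCurl₀.integral_inner_comm {Ω : Set E3} (hΩ : MeasurableSet Ω) {A C A' C' : E3 → E3}
    (h : HasCurl₀ Ω A C) (h' : HasCurl₀ Ω A' C') :
    ∫ x in Ω, inner ℝ (C x) (A' x) = ∫ x in Ω, inner ℝ (A x) (C' x) := by
  have := (h.indicator hΩ).integral_inner_comm_univ (h'.indicator hΩ)
  have hi (B D : E3 → E3) : (fun x => inner ℝ (Ω.indicator B x) (Ω.indicator D x) : E3 → ℝ)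
      = Ω.indicator fun x => inner ℝ (B x) (D x) := by
    funext x
    by_cases hx : x ∈ Ω <;> simp [hx]
  simpa only [hi, integral_indicator hΩ] using this

end MHD

/-! ### Magnetic helicity -/

namespace MHD
namespace Mesh

variable {M : Mesh}

section ipf

variable {A A' : E3 → E3} (hA : MemLp A 2 (volume.restrict M.dom))
  (hA' : MemLp A' 2 (volume.restrict M.dom))
include hA

lemma ipf_add_right (v w : M.Vec) : M.ipf A (v + w) = M.ipf A v + M.ipf A w := by
  simp only [M.ipf_eq_integral hA, toFun_add, Pi.add_apply, inner_add_right]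
  exact integral_add (hA.integrable_inner_real (M.memLp_toFun v))
    (hA.integrable_inner_real (M.memLp_toFun w))

lemma ipf_smul_right (c : ℝ) (w : M.Vec) : M.ipf A (c • w) = c * M.ipf A w := by
  simp only [M.ipf_eq_integral hA, toFun_smul, Pi.smul_apply, inner_smul_right, integral_const_mul]

lemma ipf_sub_right (v w : M.Vec) : M.ipf A (v - w) = M.ipf A v - M.ipf A w := by
  rw [sub_eq_add_neg, ← neg_one_smul ℝ w, ipf_add_right hA, ipf_smul_right hA]
  ring

include hA' in
lemma ipf_mid_left (w : M.Vec) : M.ipf (mid A A') w = 1 / 2 * (M.ipf A w + M.ipf A' w) := by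
  rw [mid, M.ipf_eq_integral ((hA.add hA').const_smul _), M.ipf_eq_integral hA,
    M.ipf_eq_integral hA',
    ← integral_add (hA.integrable_inner_real (M.memLp_toFun w))
      (hA'.integrable_inner_real (M.memLp_toFun w)), ← integral_const_mul]
  simp only [Pi.smul_apply, Pi.add_apply, inner_smul_left, inner_add_left, conj_trivial]

end ipf

lemma _root_.MHD.HasCurl₀.mid_toFun {A A' : E3 → E3} {B B' : M.Vec}
    (h : HasCurl₀ M.dom A (M.toFun B)) (h' : HasCurl₀ M.dom A' (M.toFun B')) :
    HasCurl₀ M.dom (mid A A') (M.toFun (mid B B')) := by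
  rw [mid, mid, toFun_smul, toFun_add]
  exact (h.add h').smul _

/-- Symmetry of the curl, for a potential of a broken polynomial field and a Nédélec field. -/
lemma ipf_curl {A : E3 → E3} {B v : M.Vec} {r : ℕ} (h : HasCurl₀ M.dom A (M.toFun B))
    (hv : M.MemNED r v) : M.ipf A (M.curl v) = M.ipv v B := by
  rw [M.ipf_eq_integral h.1, ipv_comm, ipv_eq_ipf, M.ipf_eq_integral (M.memLp_toFun B)]
  exact (h.integral_inner_comm M.measurableSet_dom hv.hasCurl₀).symm

section Step

variable {r q : ℕ} {p : Params} {α : Fin M.card → E3 → ℝ} {dt : ℝ} {X Y : M.State} {Z : M.Aux}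

/-- The ideal electric field is orthogonal to the magnetic field. -/
lemma IsStep.ipv_E_mid_B (h : M.IsStep r q p α dt X Y Z) : M.ipv Z.E (mid X.B Y.B) = 0 := by
  rw [ipv_comm, ← h.H_eq _ h.mem_E, ipv_comm, h.E_eq _ h.mem_H, neg_eq_zero, ipv_eq,
    ← map_zero M.polyInt]
  congr 1
  funext K
  simp only [pdot, vcross, Fin.sum_univ_three, cross_apply, Matrix.cons_val_zero,
    Matrix.cons_val_one, Matrix.cons_val, Pi.zero_apply]
  ring

variable {A₀ A₁ : E3 → E3} (h₀ : HasCurl₀ M.dom A₀ (M.toFun X.B))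
  (h₁ : HasCurl₀ M.dom A₁ (M.toFun Y.B))
include h₀ h₁

lemma helicity_sub :
    M.ipf A₁ Y.B - M.ipf A₀ X.B = 2 * M.ipf (mid A₀ A₁) (Y.B - X.B) := by
  have hs : M.ipf A₁ X.B = M.ipf A₀ Y.B := by
    rw [M.ipf_eq_integral h₁.1, M.ipf_eq_integral h₀.1,
      ← h₀.integral_inner_comm M.measurableSet_dom h₁]
    simp only [real_inner_comm]
  rw [ipf_mid_left h₀.1 h₁.1, ipf_sub_right h₀.1, ipf_sub_right h₁.1, hs]
  ring

lemma IsStep.ipf_curl_E (h : M.IsStep r q p α dt X Y Z) :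
    M.ipf (mid A₀ A₁) (M.curl Z.E) = 0 := by
  rw [ipf_curl (h₀.mid_toFun h₁) h.mem_E, h.ipv_E_mid_B]

lemma IsStep.helicity_balance (h : M.IsStep r q p α dt X Y Z) {P : M.Vec}
    (hP : M.IsDivProj r (mid A₀ A₁) P) :
    (M.ipf A₁ Y.B - M.ipf A₀ X.B) / dt
      = -2 * p.nu * M.ipv (M.curl Z.J) P - 2 * M.hForm α 1 Z.T P := by
  have hind := h.induction P hP.1
  have hE := hP.2 _ h.mem_E.memRT_curl
  rw [h.ipf_curl_E h₀ h₁, ipv_comm] at hE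
  rw [ipv_smul_left, hE, M.ipv_comm (Y.B - X.B), hP.2 _ (h.mem_B.2.sub h.mem_B.1)] at hind
  rw [helicity_sub h₀ h₁, div_eq_inv_mul]
  linear_combination 2 * hind

lemma IsStep.helicity_eq (h : M.IsStep r q p α dt X Y Z) (hdt : dt ≠ 0) (hν : p.nu = 0)
    (h0 : ∀ C, M.MemRT r C → M.hForm α 1 Z.T C = 0) : M.ipf A₁ Y.B = M.ipf A₀ X.B := by
  have hp := h.induction_pointwise h0
  have hm := (h₀.mid_toFun h₁).1
  rw [hν, neg_zero, zero_smul] at hp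
  have hz := congrArg (M.ipf (mid A₀ A₁)) hp
  rw [ipf_add_right hm, ipf_smul_right hm, h.ipf_curl_E h₀ h₁, ← zero_smul ℝ (0 : M.Vec),
    ipf_smul_right hm, zero_mul, add_zero] at hz
  have := (mul_eq_zero.1 hz).resolve_left (inv_ne_zero hdt)
  rw [← sub_eq_zero, helicity_sub h₀ h₁, this, mul_zero]

end Step

end Mesh
end MHD

/-! ### The discrete solutions -/

theorem mainTheorem3 (M : MHD.Mesh) (r q : ℕ) (p : MHD.Params) (I J : Set ℝ)
    (hI : IsOpen I) (hJ : IsOpen J)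
    (hε : ContDiffOn ℝ 1 (fun z : ℝ × ℝ => p.eps z.1 z.2) (I ×ˢ J)) :
    -- every discrete solution `X 0, …, X N` at times `t 0 < … < t N`, with auxiliary
    -- unknowns `Z k` and thermoelectric coefficient `α k` in the step from `k` to `k + 1`
    (∀ (N : ℕ) (t : ℕ → ℝ) (α : ℕ → Fin M.card → MHD.E3 → ℝ) (X : ℕ → M.State)
        (Z : ℕ → M.Aux),
      (∀ k < N, t k < t (k + 1)) →
      (∀ k < N, M.IsStep r q p (α k) (t (k + 1) - t k) (X k) (X (k + 1)) (Z k)) →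
      (∀ k ≤ N, ∀ K, ∀ x ∈ M.cell K,
        MHD.ev ((X k).rho K) x ∈ I ∧ MHD.ev ((X k).s K) x ∈ J) →
      -- conservation of mass
      (∀ k ≤ N, M.mass (X k) = M.mass (X 0)) ∧
      -- Gauss' magnetic law: in a step without thermoelectric contribution to the
      -- induction equation, the induction law holds pointwise and `div B` is unchanged
      (∀ k < N, (∀ C, M.MemRT r C → M.hForm (α k) 1 (Z k).T C = 0) →
        (t (k + 1) - t k)⁻¹ • ((X (k + 1)).B - (X k).B) + M.curl (Z k).E
            = -p.nu • M.curl (Z k).J ∧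
        M.div (X (k + 1)).B = M.div (X k).B) ∧
      ((∀ k < N, ∀ C, M.MemRT r C → M.hForm (α k) 1 (Z k).T C = 0) →
        M.div (X 0).B = 0 → ∀ k ≤ N, M.div (X k).B = 0) ∧
      -- magnetic helicity balance
      (∀ k < N, ∀ A₀ A₁ : MHD.E3 → MHD.E3,
        MHD.HasCurl₀ M.dom A₀ (M.toFun (X k).B) →
        MHD.HasCurl₀ M.dom A₁ (M.toFun (X (k + 1)).B) →
        (∀ P, M.IsDivProj r (MHD.mid A₀ A₁) P →
          (M.ipf A₁ (X (k + 1)).B - M.ipf A₀ (X k).B) / (t (k + 1) - t k)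
            = -2 * p.nu * M.ipv (M.curl (Z k).J) P - 2 * M.hForm (α k) 1 (Z k).T P) ∧
        (p.nu = 0 → (∀ C, M.MemRT r C → M.hForm (α k) 1 (Z k).T C = 0) →
          M.ipf A₁ (X (k + 1)).B = M.ipf A₀ (X k).B)) ∧
      -- energy balance, and conservation for an insulated boundary
      (∀ k < N, (M.energy p (X (k + 1)) - M.energy p (X k)) / (t (k + 1) - t k)
          = -M.eForm p 1 (Z k).T) ∧
      (p.bc = MHD.ThermalBC.neumann → ∀ k ≤ N, M.energy p (X k) = M.energy p (X 0)) ∧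
      -- Second Law, for an insulated boundary or away from the boundary
      (∀ k < N, (∀ K, ∀ x ∈ M.cell K, 0 < MHD.ev ((Z k).T K) x) →
        ∀ w, M.MemDG q w → (∀ K, ∀ x ∈ M.cell K, 0 ≤ MHD.ev (w K) x) →
        (p.bc = MHD.ThermalBC.neumann ∨ ∀ F ∈ M.boundaryFaces, w F.1 = 0) →
        0 ≤ M.cForm p w (MHD.mid (X k).u (X (k + 1)).u) (MHD.mid (X k).u (X (k + 1)).u) ∧
        0 ≤ p.nu * M.int (fun K x =>
          MHD.ev (w K) x * MHD.ev (MHD.pdot ((Z k).J K) ((Z k).J K)) x) ∧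
        0 ≤ -M.dForm p w (Z k).T (Z k).T ∧
        M.eForm p w (Z k).T = 0 ∧
        0 ≤ M.entropyRHS p (X k) (X (k + 1)) (Z k) w ∧
        0 ≤ M.entropyLHS p (α k) (t (k + 1) - t k) (X k) (X (k + 1)) (Z k) w)) ∧
    -- symmetry of the scheme under the exchange of `t_k` and `t_{k+1}`
    (∀ (α : Fin M.card → MHD.E3 → ℝ) (dt : ℝ) (X Y : M.State) (Z : M.Aux),
      M.IsStep r q p α dt X Y Z ↔ M.IsStep r q p α (-dt) Y X Z) ∧
    -- time reversibility in the absence of dissipation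
    (p.DissipationFree → ∀ (α : Fin M.card → MHD.E3 → ℝ) (dt : ℝ) (X Y : M.State),
      (M.Step r q p α dt X Y ↔ M.Step r q p α dt Y.revUB X.revUB) ∧
      ((∀ K x, α K x = 0) →
        (M.Step r q p α dt X Y ↔ M.Step r q p α dt Y.revU X.revU))) := by
  have eq_of_step {V : Type} (f : ℕ → V) (N : ℕ) (h : ∀ k < N, f (k + 1) = f k) :
      ∀ k ≤ N, f k = f 0 := by
    intro k
    induction k with
    | zero => exact fun _ => rfl
    | succ k ih => exact fun hk => (h k hk).trans (ih (Nat.le_of_succ_le hk))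
  refine ⟨fun N t α X Z ht hstep hIJ => ?_, fun α dt X Y Z => MHD.Mesh.isStep_comm,
    fun hp α dt X Y => ⟨MHD.Mesh.step_revUB_iff hp, fun hα => MHD.Mesh.step_revU_iff hp hα⟩⟩
  have hdt : ∀ k < N, t (k + 1) - t k ≠ 0 := fun k hk => (sub_pos.2 (ht k hk)).ne'
  have hE : ∀ k < N, (M.energy p (X (k + 1)) - M.energy p (X k)) / (t (k + 1) - t k)
      = -M.eForm p 1 (Z k).T := fun k hk =>
    (hstep k hk).energy_balance hε.continuousOn (hIJ k hk.le) (hIJ (k + 1) hk)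
  refine ⟨eq_of_step (fun k => M.mass (X k)) N fun k hk => (hstep k hk).mass_eq (hdt k hk),
    fun k hk h0 => ⟨(hstep k hk).induction_pointwise h0, (hstep k hk).div_eq (hdt k hk) h0⟩,
    fun h0 hdiv k hk => ?_, fun k hk A₀ A₁ h₀ h₁ =>
      ⟨fun P hP => (hstep k hk).helicity_balance h₀ h₁ hP,
        fun hν h0 => (hstep k hk).helicity_eq h₀ h₁ (hdt k hk) hν h0⟩,
    hE, fun hbc => eq_of_step (fun k => M.energy p (X k)) N fun k hk => ?_,
    fun k hk hT w hwm hw hbc => ?_⟩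
  · exact (eq_of_step (fun k => M.div (X k).B) N
      (fun k hk => (hstep k hk).div_eq (hdt k hk) (h0 k hk)) k hk).trans hdiv
  · have := hE k hk
    rw [MHD.Mesh.eForm_eq_zero (.inl hbc), neg_zero] at this
    exact sub_eq_zero.1 ((div_eq_zero_iff.1 this).resolve_right (hdt k hk))
  · have hc := MHD.Mesh.cForm_self_nonneg p hw (MHD.mid (X k).u (X (k + 1)).u)
    have hν := MHD.Mesh.nu_mul_int_nonneg p hw (Z k).J
    have hd : 0 ≤ -M.dForm p w (Z k).T (Z k).T := by
      rw [MHD.Mesh.dForm_eq_dN hbc]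
      exact neg_nonneg.2 (MHD.Mesh.dN_self_nonpos p hT hw)
    have he : M.eForm p w (Z k).T = 0 := MHD.Mesh.eForm_eq_zero hbc _
    have hR : 0 ≤ M.entropyRHS p (X k) (X (k + 1)) (Z k) w := by
      rw [MHD.Mesh.entropyRHS, he]
      linarith
    exact ⟨hc, hν, hd, he, hR, ((hstep k hk).entropy w hwm).symm ▸ hR⟩
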